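/- **Setting.** Let $\rho>0$ be a density. A *Medium III* tensor with moduli $(\mu_{11},\mu_{44},\mu_{66})$ is the fourth-order tensor on $\mathbb R^3$ whose Voigt matrix has diagonal $(\mu_{11},\mu_{11},\mu_{11},\mu_{44},\mu_{44},\mu_{66})$, entry $\mu_{11}-2\mu_{66}$ at $(1,2)$, entries $\mu_{11}-2\mu_{44}$ at $(1,3)$ and $(2,3)$ (symmetric), and zeros elsewhere. Let the stiffness tensor $C$ (moduli $c_{pq}$, $c_{11},c_{44}>0$) and the viscosity tensor $V$ (moduli $v_{pq}$) be of this type. The eigenvalues of the Christoffel tensor $\Gamma_{ij}(\nabla)=\sum_{k,l}C_{kilj}\partial_k\partial_l$ are $L_1^c=c_{11}\Delta$, $L_2^c=c_{66}(\partial_1^2+\partial_2^2)+c_{44}\partial_3^2$, $L_3^c=c_{44}\Delta$ (likewise $L_i^v$ for $V$), and we assume $L^v_i=\beta_iL^c_i$ with real $\beta_i$. Put $D_1=(\partial_1,\partial_2,\partial_3)$, $D_2=(\partial_2,-\partial_1,0)$, $M_1=\Delta$, $M_2=\partial_1^2+\partial_2^2$ and $c_p=\sqrt{c_{pp}/\rho}$.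 Fix a frequency $\omega\in\mathbb R$, the value $\widehat{\mathcal A}=\widehat{\mathcal A}(\omega)\in\mathbb C$ of the Fourier transform of the loss operator, and a branch of the complex square root. Put $K_i=\sqrt{\omega^2(1-\beta_i\widehat{\mathcal A})}$ and $$\Phi_i(h)=(1-\beta_i\widehat{\mathcal A})\frac{e^{\sqrt{-1}K_ih}}{4\pi\rho\, b_{i1}b_{i2}b_{i3}\,h},\qquad \Phi_i(x)=\Phi_i(\tau_i(x)),\qquad \tau_i(x)=\Big(\sum_{j=1}^3 x_j^2/b_{ij}^2\Big)^{1/2},$$ where $b_1=(c_1,c_1,c_1)$, $b_2=(c_6,c_6,c_4)$, $b_3=(c_4,c_4,c_4)$. The Green function of Medium III is $$\widehat G=\Phi_3I+D_1\otimes D_1\,M_1^{-1}(\Phi_1-\Phi_3)+D_2\otimes D_2\,M_2^{-1}(\Phi_2-\Phi_3)\qquad(x\neq0).$$ Here $\Psi=M^{-1}f$ denotes a solution of $M\Psi=f$ on $\mathbb R^3\setminus\{0\}$ that is smooth there, has bounded gradient near $0$, and is invariant under every linear isometry of $\mathbb R^3$ that leaves both $M$ and $f$ invariant. **Theorem.**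 Suppose $c_{66}=c_{44}$. Then $C$ and $V$ are isotropic, $\beta_2=\beta_3$, $\tau_1=r/c_1$, $\tau_2=\tau_3=r/c_4$ and $\Phi_2=\Phi_3$, where $r=|x|$. Each $\Phi_i$ is locally integrable and satisfies $L_i^c\Phi_i+\rho\omega^2(1-\beta_i\widehat{\mathcal A})\Phi_i=-(1-\beta_i\widehat{\mathcal A})\delta$ in the sense of distributions on $\mathbb R^3$. The Green function $\widehat G$ exists, is uniquely determined at every $x\ne0$, and with $\hat r=x/r$ equals $$\widehat G=\Phi_2I+D_1\otimes D_1M_1^{-1}(\Phi_1-\Phi_2)=\Phi_1\,\hat r\otimes\hat r+\Phi_2\,(I-\hat r\otimes\hat r)+\frac1{r^3}\Big[c_1^3\int_0^{r/c_1}h^2\Phi_1(h)\,dh-c_4^3\int_0^{r/c_4}h^2\Phi_2(h)\,dh\Big](I-3\hat r\otimes\hat r),$$ for any choice of the potential $M_1^{-1}(\Phi_1-\Phi_2)$ in the above sense. Moreover, if $1-\beta_i\widehat{\mathcal A}\neq0$ for $i=1,2,3$, then $\widehat G$ is locally integrable and is a Green function of the isotropic viscoelastic medium in the frequency domain: $$\widetilde\Gamma(\nabla)\widehat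 G+\rho\omega^2\widehat G=-\delta I$$ in the sense of distributions on $\mathbb R^3$, where $\widetilde\Gamma$ is the Christoffel tensor with the complex moduli $c_{11}/(1-\beta_1\widehat{\mathcal A})$, $c_{44}/(1-\beta_3\widehat{\mathcal A})$ and $c_{66}/(1-\beta_2\widehat{\mathcal A})$. These agree with the moduli of $C+\widehat{\mathcal A}V$ up to terms of second order in $\beta_i$. -/

import Mathlib

open MeasureTheory Filter Topology
open scoped ContDiff

/-- Physical space. -/
abbrev E3 : Type := EuclideanSpace ℝ (Fin 3)

/-! ### Constant-coefficient second order operators -/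

/-- The partial derivative `∂ᵢ f`. -/
noncomputable def pderiv3 (i : Fin 3) (f : E3 → ℂ) : E3 → ℂ :=
  fun x => fderiv ℝ f x (EuclideanSpace.single i 1)

/-- The quadratic form `q(n) = ∑ⱼₖ qⱼₖ nⱼ nₖ`. -/
def quadSymbol (q : Matrix (Fin 3) (Fin 3) ℝ) (n : E3) : ℝ :=
  ∑ j, ∑ k, q j k * n j * n k

/-- The differential operator `q(∇) = ∑ⱼₖ qⱼₖ ∂ⱼ ∂ₖ`. -/
noncomputable def quadOp (q : Matrix (Fin 3) (Fin 3) ℂ) (f : E3 → ℂ) : E3 → ℂ :=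
  fun x => ∑ j, ∑ k, q j k * pderiv3 j (pderiv3 k f) x

/-- A real matrix of coefficients seen as a complex one. -/
noncomputable def toC (q : Matrix (Fin 3) (Fin 3) ℝ) : Matrix (Fin 3) (Fin 3) ℂ :=
  q.map (fun a => (a : ℂ))

/-! ### Medium III: stiffness tensor, Christoffel tensor and its spectral data -/

/-- The three independent moduli `μ₁₁, μ₄₄, μ₆₆` of a Medium III tensor. -/
structure Moduli (R : Type) where
  m11 : R
  m44 : R
  m66 : R

/-- The Voigt index `p(i,j)` (with indices starting from `0`). -/
def voigtIndex : Fin 3 → Fin 3 → Fin 6 :=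
  ![![0, 5, 4], ![5, 1, 3], ![4, 3, 2]]

/-- The Voigt matrix of Medium III. -/
def mediumIIIVoigt {R : Type} [CommRing R] (μ : Moduli R) : Matrix (Fin 6) (Fin 6) R :=
  !![μ.m11, μ.m11 - 2 * μ.m66, μ.m11 - 2 * μ.m44, 0, 0, 0;
     μ.m11 - 2 * μ.m66, μ.m11, μ.m11 - 2 * μ.m44, 0, 0, 0;
     μ.m11 - 2 * μ.m44, μ.m11 - 2 * μ.m44, μ.m11, 0, 0, 0;
     0, 0, 0, μ.m44, 0, 0;
     0, 0, 0, 0, μ.m44, 0;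
     0, 0, 0, 0, 0, μ.m66]

/-- The fourth order tensor `C_{ijkl} = c_{p(i,j) p(k,l)}` of Medium III. -/
def mediumIIITensor {R : Type} [CommRing R] (μ : Moduli R) (i j k l : Fin 3) : R :=
  mediumIIIVoigt μ (voigtIndex i j) (voigtIndex k l)

/-- A fourth order tensor is isotropic if it is invariant under every orthogonal change of
axes. -/
def IsIsotropicTensor (C : Fin 3 → Fin 3 → Fin 3 → Fin 3 → ℝ) : Prop :=
  ∀ Q ∈ Matrix.orthogonalGroup (Fin 3) ℝ, ∀ i j k l : Fin 3,
    ∑ a, ∑ b, ∑ c, ∑ d, Q i a * Q j b * Q k c * Q l d * C a b c d = C i j k l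

/-- The `(i,j)` entry of the Christoffel tensor, `Γᵢⱼ(n) = ∑ₖₗ C_{kilj} nₖ nₗ`, given by its
matrix of coefficients in `(k,l)`. -/
def christoffel {R : Type} [CommRing R] (μ : Moduli R) (i j : Fin 3) :
    Matrix (Fin 3) (Fin 3) R :=
  Matrix.of fun k l => mediumIIITensor μ k i l j

/-- The eigenvalues `L₁, L₂, L₃` of the Christoffel tensor of Medium III:
`μ₁₁ Δ`, `μ₆₆ (∂₁² + ∂₂²) + μ₄₄ ∂₃²` and `μ₄₄ Δ`. -/
def eigL (μ : Moduli ℝ) : Fin 3 → Matrix (Fin 3) (Fin 3) ℝ :=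
  ![Matrix.diagonal ![μ.m11, μ.m11, μ.m11],
    Matrix.diagonal ![μ.m66, μ.m66, μ.m44],
    Matrix.diagonal ![μ.m44, μ.m44, μ.m44]]

/-- The eigenvector `D₁ = (∂₁, ∂₂, ∂₃)`: row `a` holds the coefficients of its component `a`. -/
def vecD1 : Matrix (Fin 3) (Fin 3) ℝ := !![1, 0, 0; 0, 1, 0; 0, 0, 1]

/-- The eigenvector `D₂ = (∂₂, -∂₁, 0)`. -/
def vecD2 : Matrix (Fin 3) (Fin 3) ℝ := !![0, 1, 0; -1, 0, 0; 0, 0, 0]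

/-- The entry `(a,b)` of `D ⊗ D`, a quadratic form in `∇`. -/
def tensorSq (D : Matrix (Fin 3) (Fin 3) ℝ) (a b : Fin 3) : Matrix (Fin 3) (Fin 3) ℝ :=
  Matrix.of fun j k => D a j * D b k

/-- `M = D · D`, a quadratic form in `∇`: `Δ` for `D₁` and `∂₁² + ∂₂²` for `D₂`. -/
def normSqM (D : Matrix (Fin 3) (Fin 3) ℝ) : Matrix (Fin 3) (Fin 3) ℝ :=
  ∑ a, tensorSq D a a

/-- `Ψ = M⁻¹ f`: the solution of `M(∇) Ψ = f` that is smooth away from the origin, has bounded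
gradient at the origin (so that no point source sits there) and is symmetric in the sense that
it inherits every symmetry that is shared by `M` and the source `f`. -/
def IsPotential (M : Matrix (Fin 3) (Fin 3) ℝ) (f Ψ : E3 → ℂ) : Prop :=
  ContDiffOn ℝ ∞ Ψ {0}ᶜ ∧
  (∀ x, x ≠ 0 → quadOp (toC M) Ψ x = f x) ∧
  (∃ B : ℝ, ∀ᶠ x in 𝓝[≠] (0 : E3), ‖fderiv ℝ Ψ x‖ ≤ B) ∧
  (∀ U : E3 ≃ₗᵢ[ℝ] E3, (∀ n, quadSymbol M (U n) = quadSymbol M n) →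
    (∀ x, f (U x) = f x) → ∀ x, Ψ (U x) = Ψ x)

/-! ### The scalar wave functions -/

/-- The data of the problem at a fixed frequency: the density `ρ`, the stiffness moduli `c`, the
ratios `β₁, β₂, β₃` of viscosity to stiffness, the frequency `freq = ω`, the value `A = Â(ω)` of the
Fourier transform of the loss operator, and a branch `sq` of the complex square root. -/
structure WaveData where
  ρ : ℝ
  c : Moduli ℝ
  β : Fin 3 → ℝ
  freq : ℝ
  A : ℂ
  sq : ℂ → ℂ

namespace WaveData

variable (P : WaveData)

/-- `c₁ = √(c₁₁/ρ)`. -/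
noncomputable def c1 : ℝ := √(P.c.m11 / P.ρ)

/-- `c₄ = √(c₄₄/ρ)`. -/
noncomputable def c4 : ℝ := √(P.c.m44 / P.ρ)

/-- `c₆ = √(c₆₆/ρ)`. -/
noncomputable def c6 : ℝ := √(P.c.m66 / P.ρ)

/-- The constants `(b₁, b₂, b₃)` of the three wave modes of Medium III. -/
noncomputable def b : Fin 3 → Fin 3 → ℝ :=
  ![![P.c1, P.c1, P.c1], ![P.c6, P.c6, P.c4], ![P.c4, P.c4, P.c4]]

/-- The factor `1 - βᵢ Â(ω)`. -/
noncomputable def loss (i : Fin 3) : ℂ := 1 - P.β i * P.A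

/-- `Kᵢ(ω) = √(ω² (1 - βᵢ Â(ω)))`. -/
noncomputable def K (i : Fin 3) : ℂ := P.sq ((P.freq : ℂ) ^ 2 * P.loss i)

/-- The travel time `τᵢ(x) = √(x₁²/b₁² + x₂²/b₂² + x₃²/b₃²)`. -/
noncomputable def τ (i : Fin 3) (x : E3) : ℝ := √(∑ j, x j ^ 2 / P.b i j ^ 2)

/-- `Φᵢ` as a function `Φᵢ(h, ω)` of the travel time `h`. -/
noncomputable def profile (i : Fin 3) (h : ℝ) : ℂ :=
  P.loss i * Complex.exp (Complex.I * P.K i * h) /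
    (4 * (∏ j, P.b i j : ℝ) * P.ρ * Real.pi * h)

/-- `Φᵢ(x, ω)`. -/
noncomputable def Φ (i : Fin 3) (x : E3) : ℂ := P.profile i (P.τ i x)

/-- `G` is the spectral Green function of Medium III,
`G = Φ₃ I + D₁⊗D₁ M₁⁻¹ (Φ₁ - Φ₃) + D₂⊗D₂ M₂⁻¹ (Φ₂ - Φ₃)` away from the source. -/
def IsMediumIIIGreen (G : E3 → Matrix (Fin 3) (Fin 3) ℂ) : Prop :=
  ∃ Ψ₁ Ψ₂ : E3 → ℂ,
    IsPotential (normSqM vecD1) (fun x => P.Φ 0 x - P.Φ 2 x) Ψ₁ ∧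
    IsPotential (normSqM vecD2) (fun x => P.Φ 1 x - P.Φ 2 x) Ψ₂ ∧
    ∀ x, x ≠ 0 → G x = P.Φ 2 x • (1 : Matrix (Fin 3) (Fin 3) ℂ) +
      (Matrix.of fun a b => quadOp (toC (tensorSq vecD1 a b)) Ψ₁ x) +
      (Matrix.of fun a b => quadOp (toC (tensorSq vecD2 a b)) Ψ₂ x)

/-- The closed form of the isotropic Green function,
`Φ₁ r̂⊗r̂ + Φ₂ (I - r̂⊗r̂)
  + r⁻³ [c₁³ ∫₀^{r/c₁} h² Φ₁(h) dh - c₄³ ∫₀^{r/c₄} h² Φ₂(h) dh] (I - 3 r̂⊗r̂)`. -/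
noncomputable def isotropicGreen (x : E3) : Matrix (Fin 3) (Fin 3) ℂ :=
  let r : ℝ := ‖x‖
  let rr : Matrix (Fin 3) (Fin 3) ℂ := Matrix.of fun i j => ((x i / r * (x j / r) : ℝ) : ℂ)
  P.Φ 0 x • rr + P.Φ 1 x • (1 - rr) +
    ((r : ℂ) ^ 3)⁻¹ •
      (((P.c1 : ℂ) ^ 3 * ∫ h in (0 : ℝ)..(r / P.c1), (h : ℂ) ^ 2 * P.profile 0 h) -
        ((P.c4 : ℂ) ^ 3 * ∫ h in (0 : ℝ)..(r / P.c4), (h : ℂ) ^ 2 * P.profile 1 h)) •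
      (1 - (3 : ℂ) • rr)

/-- The frequency domain moduli: `c₁₁/(1 - β₁Â)`, `c₄₄/(1 - β₃Â)` and `c₆₆/(1 - β₂Â)`. Up to
terms of second order in `βᵢ` these are the moduli `c + Â v` of the viscoelastic law. -/
noncomputable def viscoModuli : Moduli ℂ where
  m11 := P.c.m11 / P.loss 0
  m44 := P.c.m44 / P.loss 2
  m66 := P.c.m66 / P.loss 1

end WaveData

/-- `q(∇) f + κ f = s δ` on `ℝ³`, in the sense of distributions. -/
def IsScalarFundamental (q : Matrix (Fin 3) (Fin 3) ℂ) (κ s : ℂ) (f : E3 → ℂ) : Prop :=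
  LocallyIntegrable f volume ∧
  ∀ φ : E3 → ℂ, ContDiff ℝ ∞ φ → HasCompactSupport φ →
    ∫ x, f x * (quadOp q φ x + κ * φ x) = s * φ 0

/-- `Γ(∇) G + κ G = s δ I` on `ℝ³` for a Christoffel tensor `Γ`, in the sense of
distributions. -/
def IsElasticFundamental (μ : Moduli ℂ) (κ s : ℂ) (G : E3 → Matrix (Fin 3) (Fin 3) ℂ) : Prop :=
  (∀ i j, LocallyIntegrable (fun x => G x i j) volume) ∧
  ∀ φ : E3 → ℂ, ContDiff ℝ ∞ φ → HasCompactSupport φ → ∀ i j : Fin 3,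
    ∫ x, ∑ k, G x k j *
        (quadOp (christoffel μ i k) φ x + κ * (1 : Matrix (Fin 3) (Fin 3) ℂ) i k * φ x) =
      s * (1 : Matrix (Fin 3) (Fin 3) ℂ) i j * φ 0

/-! ### Local integrability of functions with a singularity of order two -/

/-! Indices are those of the code, starting at 0. When `c66 = c44`, all three modes are radial. With
`w_k(r) = exp(ikr)/(4πr)` each `Φ i` is `α w_k(|x|)`, where `α = loss i / m` for the modulus `m` of
the mode, and `κ = ρω²` satisfies `κ α = k²` (`wavenumber_sq`). Proportionality of the viscous and
elastic eigenvalues forces `v66 = v44` and `β 1 = β 2`, hence `Φ 1 = Φ 2`, and the source of the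
second potential vanishes.

That second potential is invariant under rotations about the third axis and harmonic in the
horizontal variables. Away from the plane `x₃ = 0` it is smooth across the axis, so the logarithmic
solution is excluded and its horizontal gradient is zero; continuity covers the plane. Thus `D₂⊗D₂`
contributes nothing, although the potential itself may depend on `x₃`
(`IsPotential.quadOp_tensorSq_vecD2_eq_zero`).

The first potential is radial, because reflections act transitively on spheres. Its equation reads
`(r² u')' = r² g`, and the bounded gradient removes the integration constant, so `r² u' = ∫₀^r s²
g`. This determines the Hessian and gives the closed form (`IsPotential.pderiv3_pderiv3_eq`). For
existence, `Δw_k = -k² w_k` off the origin suggests `u = (w_{k₁} - w_{k₀})/κ`, whose `1/r`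
singularities cancel; for `κ = 0` a linear function of `r` serves (`exists_radial_potential`).

For the distributional equation, `Δ + k²` applied to `w_k` gives `-δ`
(`integral_sphericalWave_mul`). Applied to `α₁ w_{k₁} I + ∇∇Ψ`, the isotropic operator gives `-δ I`
plus the Hessian of `w_{k₀} - w_{k₁} + κΨ`, and this combination is zero. The potential is mild
enough at the origin for two integrations by parts to leave no point term
(`isElasticFundamental_of_radial`). -/

theorem locallyIntegrable_of_norm_sq_mul_norm_le {g : E3 → ℂ} (hg : ContinuousOn g {0}ᶜ)
    (hb : ∀ R : ℝ, ∃ C : ℝ, ∀ x : E3, x ≠ 0 → ‖x‖ ≤ R → ‖x‖ ^ 2 * ‖g x‖ ≤ C) :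
    LocallyIntegrable g volume := by
  have hm : AEStronglyMeasurable g volume := by
    have h := hg.aestronglyMeasurable (μ := (volume : Measure E3))
      (measurableSet_singleton (0 : E3)).compl
    rwa [restrict_compl_singleton] at h
  rw [locallyIntegrable_iff]
  intro k hk
  obtain ⟨R, hR⟩ := hk.isBounded.subset_ball (0 : E3)
  obtain ⟨C, hC⟩ := hb R
  have hint : IntegrableOn (fun x : E3 => C * (‖x‖ ^ 2)⁻¹) (Metric.ball 0 R) volume := by
    -- In polar coordinates the volume factor `r²` cancels the singularity, leaving a constant on a
    -- bounded interval.
    refine (integrableOn_fun_norm_addHaar (E := E3) volume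
      (f := fun r : ℝ => C * (r ^ 2)⁻¹)).2 ?_
    have hc : IntegrableOn (fun _ : ℝ => C) (Set.Ioo 0 R) volume := by
      simp
    refine hc.congr_fun (fun y hy => ?_) measurableSet_Ioo
    have : y ≠ 0 := hy.1.ne'
    simp only [finrank_euclideanSpace, Fintype.card_fin, smul_eq_mul]
    field_simp
  refine IntegrableOn.mono_set ?_ hR
  refine Integrable.mono' hint hm.restrict ?_
  have h0 : ∀ᵐ x ∂(volume : Measure E3), x ≠ 0 := by
    simp [ae_iff]
  filter_upwards [ae_restrict_of_ae h0, ae_restrict_mem Metric.isOpen_ball.measurableSet]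
    with x hx hxR
  have h := hC x hx (by simpa using (mem_ball_zero_iff.1 hxR).le)
  have : 0 < ‖x‖ ^ 2 := by positivity
  rw [← div_eq_mul_inv, le_div_iff₀ this]
  linarith

theorem MeasureTheory.LocallyIntegrable.integrable_mul_of_hasCompactSupport {f g : E3 → ℂ}
    (hf : LocallyIntegrable f volume) (hg : Continuous g) (hc : HasCompactSupport g) :
    Integrable (fun x => f x * g x) volume := by
  simpa [mul_comm] using hf.integrable_smul_left_of_hasCompactSupport hg hc

/-! ### Weak derivatives across a point -/

theorem hasDerivAt_comp_of_hasDerivAt_single {f : E3 → ℂ} {x : E3} (hf : DifferentiableAt ℝ f x)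
    (i : Fin 3) {γ : ℝ → E3} {t : ℝ} (hγ : HasDerivAt γ (EuclideanSpace.single i 1) t)
    (hx : γ t = x) : HasDerivAt (fun s => f (γ s)) (pderiv3 i f x) t := by
  subst hx
  exact hf.hasFDerivAt.comp_hasDerivAt t hγ

theorem hasDerivAt_toLp_insertNth (i : Fin 3) (y : Fin 2 → ℝ) (t : ℝ) :
    HasDerivAt (fun s : ℝ => (WithLp.toLp 2 (i.insertNth (α := fun _ => ℝ) s y) : E3))
      (EuclideanSpace.single i 1) t := by
  have h : (fun s : ℝ => (WithLp.toLp 2 (i.insertNth (α := fun _ => ℝ) s y) : E3)) =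
      fun s => WithLp.toLp 2 (i.insertNth (α := fun _ => ℝ) 0 y) +
        s • EuclideanSpace.single i (1 : ℝ) := by
    funext s
    ext j
    refine Fin.succAboveCases i ?_ (fun k => ?_) j
    · simp
    · simp
  rw [h]
  simpa using ((hasDerivAt_id t).smul_const
    (EuclideanSpace.single i (1 : ℝ) : E3)).const_add
      (WithLp.toLp 2 (i.insertNth (α := fun _ => ℝ) 0 y) : E3)

theorem integral_eq_integral_integral_insertNth {g : E3 → ℂ} (hg : Integrable g volume)
    (i : Fin 3) :
    (∫ x, g x = ∫ y : Fin 2 → ℝ, ∫ t : ℝ, g (WithLp.toLp 2 (i.insertNth t y))) ∧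
    ∀ᵐ y : Fin 2 → ℝ, Integrable (fun t : ℝ => g (WithLp.toLp 2 (i.insertNth t y))) := by
  have h1 := PiLp.volume_preserving_toLp (Fin 3)
  have h2 := (volume_preserving_piFinSuccAbove (fun _ : Fin 3 => ℝ) i).symm
  have h3 : MeasurePreserving
      (fun p : ℝ × (Fin 2 → ℝ) => (WithLp.toLp 2 (i.insertNth p.1 p.2) : E3)) volume volume :=
    h1.comp h2
  have he : MeasurableEmbedding
      (fun p : ℝ × (Fin 2 → ℝ) => (WithLp.toLp 2 (i.insertNth p.1 p.2) : E3)) :=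
    (MeasurableEquiv.toLp 2 (Fin 3 → ℝ)).measurableEmbedding.comp
      (MeasurableEquiv.piFinSuccAbove (fun _ : Fin 3 => ℝ) i).symm.measurableEmbedding
  have hi := (h3.integrable_comp_emb he).2 hg
  refine ⟨?_, ?_⟩
  · rw [← h3.integral_comp he]
    exact integral_prod_symm _ hi
  · exact hi.prod_left_ae

/-- A point is invisible to integration by parts here: by Fubini the integral splits over lines
parallel to the `i`-th axis, and almost every such line misses the origin. On it `u φ` is
differentiable with integrable derivative, so that derivative integrates to zero. -/
theorem integral_mul_pderiv3_eq_neg {u φ : E3 → ℂ} (i : Fin 3)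
    (hu : ∀ x, x ≠ 0 → DifferentiableAt ℝ u x) (hul : LocallyIntegrable u volume)
    (hul' : LocallyIntegrable (pderiv3 i u) volume)
    (hφ : ContDiff ℝ 1 φ) (hc : HasCompactSupport φ) :
    ∫ x, u x * pderiv3 i φ x = - ∫ x, pderiv3 i u x * φ x := by
  have hdφ : Continuous (pderiv3 i φ) :=
    (hφ.continuous_fderiv one_ne_zero).clm_apply continuous_const
  have i1 : Integrable (fun x => u x * pderiv3 i φ x) volume :=
    hul.integrable_mul_of_hasCompactSupport hdφ (hc.fderiv_apply ℝ _)
  have i2 : Integrable (fun x => pderiv3 i u x * φ x) volume :=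
    hul'.integrable_mul_of_hasCompactSupport hφ.continuous hc
  have i3 : Integrable (fun x => u x * φ x) volume :=
    hul.integrable_mul_of_hasCompactSupport hφ.continuous hc
  obtain ⟨e, hae⟩ := integral_eq_integral_integral_insertNth (i2.add i1) i
  obtain ⟨-, hae'⟩ := integral_eq_integral_integral_insertNth i3 i
  have hz : ∫ x, (pderiv3 i u x * φ x + u x * pderiv3 i φ x) = 0 := by
    refine e.trans ?_
    refine integral_eq_zero_of_ae ?_
    have h0 : ∀ᵐ y : Fin 2 → ℝ, y ≠ 0 := by simp [ae_iff]
    filter_upwards [hae, hae', h0] with y hy hy' hy0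
    refine integral_eq_zero_of_hasDerivAt_of_integrable (fun t => ?_) hy hy'
    have hne : (WithLp.toLp 2 (i.insertNth t y) : E3) ≠ 0 := by
      intro h
      apply hy0
      funext k
      have := congrArg (fun z : E3 => z (i.succAbove k)) h
      simpa using this
    have hγ := hasDerivAt_toLp_insertNth i y t
    exact (hasDerivAt_comp_of_hasDerivAt_single (hu _ hne) i hγ rfl).mul
      (hasDerivAt_comp_of_hasDerivAt_single (hφ.differentiable one_ne_zero _) i hγ rfl)
  rw [integral_add i2 i1] at hz
  linear_combination hz

/-! ### Polar coordinates -/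

theorem integral_eq_integral_toSphere {g : E3 → ℂ} (hg : Integrable g volume) :
    ∫ x, g x = ∫ σ : Metric.sphere (0 : E3) 1, (∫ r in Set.Ioi (0 : ℝ), (r : ℂ) ^ 2 *
      g (r • (σ : E3))) ∂(volume : Measure E3).toSphere := by
  have hmp := (volume : Measure E3).measurePreserving_homeomorphUnitSphereProd
  have hme := (homeomorphUnitSphereProd E3).measurableEmbedding
  have hcoe : ∀ x : ({0}ᶜ : Set E3), g x =
      (fun p : Metric.sphere (0 : E3) 1 × Set.Ioi (0 : ℝ) => g ((p.2 : ℝ) • (p.1 : E3)))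
        (homeomorphUnitSphereProd E3 x) := by
    intro x
    have := homeomorphUnitSphereProd_symm_apply_coe E3 (homeomorphUnitSphereProd E3 x)
    rw [Homeomorph.symm_apply_apply] at this
    simp only [← this]
  have hint : Integrable
      (fun p : Metric.sphere (0 : E3) 1 × Set.Ioi (0 : ℝ) => g ((p.2 : ℝ) • (p.1 : E3)))
      ((volume : Measure E3).toSphere.prod
        (Measure.volumeIoiPow (Module.finrank ℝ E3 - 1))) := by
    rw [← hmp.integrable_comp_emb hme]
    have h : IntegrableOn g ({0}ᶜ : Set E3) volume := hg.integrableOn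
    rw [integrableOn_iff_comap_subtypeVal (measurableSet_singleton _).compl] at h
    refine h.congr (ae_of_all _ fun x => ?_)
    exact hcoe x
  calc ∫ x, g x = ∫ x : ({0}ᶜ : Set E3), g x ∂((volume : Measure E3).comap (↑)) := by
        rw [integral_subtype_comap (measurableSet_singleton _).compl g,
          restrict_compl_singleton]
    _ = ∫ p : Metric.sphere (0 : E3) 1 × Set.Ioi (0 : ℝ), g ((p.2 : ℝ) • (p.1 : E3))
          ∂((volume : Measure E3).toSphere.prod
            (Measure.volumeIoiPow (Module.finrank ℝ E3 - 1))) := by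
        rw [← hmp.integral_comp hme]
        exact integral_congr_ae (ae_of_all _ hcoe)
    _ = _ := by
        rw [integral_prod _ hint]
        refine integral_congr_ae (ae_of_all _ fun σ => ?_)
        simp only [Measure.volumeIoiPow, ENNReal.ofReal]
        rw [integral_withDensity_eq_integral_smul
          ((measurable_subtype_coe.pow_const _).real_toNNReal),
          integral_subtype_comap measurableSet_Ioi fun a : ℝ =>
            Real.toNNReal (a ^ (Module.finrank ℝ E3 - 1)) • g (a • (σ : E3))]
        refine setIntegral_congr_fun measurableSet_Ioi fun r hr => ?_
        simp only [NNReal.smul_def]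
        rw [Real.coe_toNNReal _ (pow_nonneg (le_of_lt hr) _)]
        simp [Complex.real_smul]

theorem toSphere_real_univ_E3 :
    (volume : Measure E3).toSphere.real Set.univ = 4 * Real.pi := by
  rw [Measure.toSphere_real_apply_univ, measureReal_def, EuclideanSpace.volume_ball_fin_three,
    ENNReal.ofReal_one, one_pow, one_mul, ENNReal.toReal_ofReal (by positivity)]
  simp
  ring

/-- The integrand is the divergence of `a(r) φ r̂ / r²`. On each ray the Jacobian `r²` cancels the
denominator and leaves the derivative of `a(r) φ(rσ)`, which integrates to `-a(0) φ(0)`; the sphere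
has area `4π`. This is the source of every delta function below. -/
theorem integral_radial_divergence {a a' : ℝ → ℂ} (ha : ∀ r, HasDerivAt a (a' r) r)
    (ha' : Continuous a') {φ : E3 → ℂ} (hφ : ContDiff ℝ 1 φ) (hc : HasCompactSupport φ) :
    ∫ x : E3, (a ‖x‖ * fderiv ℝ φ x (‖x‖⁻¹ • x) + a' ‖x‖ * φ x) / (‖x‖ : ℂ) ^ 2 =
      -(4 * Real.pi * a 0 * φ 0) := by
  have hac : Continuous a := continuous_iff_continuousAt.2 fun r => (ha r).continuousAt
  have hdφ : Continuous (fderiv ℝ φ) := hφ.continuous_fderiv one_ne_zero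
  obtain ⟨R, hR⟩ := hc.isBounded.subset_ball (0 : E3)
  have hφ0 : ∀ x : E3, R ≤ ‖x‖ → φ x = 0 := fun x hx => by
    by_contra h
    have := hR (subset_tsupport _ h)
    rw [mem_ball_zero_iff] at this
    linarith
  obtain ⟨Cd, hCd⟩ := (hc.fderiv ℝ).exists_bound_of_continuous hdφ
  obtain ⟨Cφ, hCφ⟩ := hc.exists_bound_of_continuous hφ.continuous
  have hint : Integrable (fun x : E3 =>
      (a ‖x‖ * fderiv ℝ φ x (‖x‖⁻¹ • x) + a' ‖x‖ * φ x) / (‖x‖ : ℂ) ^ 2) volume := by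
    have hl : LocallyIntegrable (fun x : E3 =>
        (a ‖x‖ * fderiv ℝ φ x (‖x‖⁻¹ • x) + a' ‖x‖ * φ x) / (‖x‖ : ℂ) ^ 2) volume := by
      refine locallyIntegrable_of_norm_sq_mul_norm_le ?_ fun S => ?_
      · have h1 : ContinuousOn (fun x : E3 => ‖x‖⁻¹ • x) {0}ᶜ :=
          (continuousOn_id.norm.inv₀ fun x hx => norm_ne_zero_iff.2 hx).smul continuousOn_id
        refine ContinuousOn.div ?_ (by fun_prop) fun x hx => ?_
        · exact (((hac.comp continuous_norm).continuousOn.mul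
            (hdφ.continuousOn.clm_apply h1)).add
              ((ha'.comp continuous_norm).mul hφ.continuous).continuousOn)
        · simpa using hx
      · obtain ⟨M, hM⟩ := (isCompact_Icc (a := (0 : ℝ)) (b := S)).exists_bound_of_continuousOn
          hac.continuousOn
        obtain ⟨M', hM'⟩ := (isCompact_Icc (a := (0 : ℝ)) (b := S)).exists_bound_of_continuousOn
          ha'.continuousOn
        refine ⟨M * Cd + M' * Cφ, fun x hx hxS => ?_⟩
        have hxm : ‖x‖ ∈ Set.Icc 0 S := ⟨norm_nonneg _, hxS⟩
        have hn : 0 < ‖x‖ := norm_pos_iff.2 hx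
        rw [norm_div, norm_pow, Complex.norm_real, norm_norm, mul_div_cancel₀ _ (by positivity)]
        refine (norm_add_le _ _).trans ?_
        rw [norm_mul, norm_mul]
        refine add_le_add (mul_le_mul (hM _ hxm) ?_ (norm_nonneg _)
          ((norm_nonneg _).trans (hM _ hxm))) (mul_le_mul (hM' _ hxm) (hCφ x) (norm_nonneg _)
          ((norm_nonneg _).trans (hM' _ hxm)))
        refine ((fderiv ℝ φ x).le_opNorm _).trans ?_
        rw [norm_smul, norm_inv, norm_norm, inv_mul_cancel₀ hn.ne', mul_one]
        exact hCd x
    refine (integrableOn_iff_integrable_of_support_subset (s := tsupport φ) ?_).1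
      (locallyIntegrable_iff.1 hl _ hc)
    intro x hx
    by_contra h
    apply hx
    have h1 : φ x = 0 := image_eq_zero_of_notMem_tsupport h
    have h2 : fderiv ℝ φ x = 0 := by
      have := fun h' => h (support_fderiv_subset ℝ (f := φ) h')
      simpa using this
    simp [h1, h2]
  rw [integral_eq_integral_toSphere hint]
  have hinner : ∀ σ : Metric.sphere (0 : E3) 1, ∫ r in Set.Ioi (0 : ℝ), (r : ℂ) ^ 2 *
      ((a ‖r • (σ : E3)‖ * fderiv ℝ φ (r • (σ : E3)) (‖r • (σ : E3)‖⁻¹ • (r • (σ : E3))) +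
        a' ‖r • (σ : E3)‖ * φ (r • (σ : E3))) / (‖r • (σ : E3)‖ : ℂ) ^ 2) = -(a 0 * φ 0) := by
    intro σ
    have hσ : ‖(σ : E3)‖ = 1 := by simp
    have hd : ∀ r : ℝ, HasDerivAt (fun r : ℝ => a r * φ (r • (σ : E3)))
        (a' r * φ (r • (σ : E3)) + a r * fderiv ℝ φ (r • (σ : E3)) σ) r := fun r => by
      refine (ha r).mul ?_
      refine (hφ.differentiable one_ne_zero _).hasFDerivAt.comp_hasDerivAt r ?_
      simpa using (hasDerivAt_id r).smul_const (σ : E3)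
    have hline : Continuous fun r : ℝ => r • (σ : E3) := by fun_prop
    have hcont : Continuous fun r : ℝ =>
        a' r * φ (r • (σ : E3)) + a r * fderiv ℝ φ (r • (σ : E3)) σ :=
      (ha'.mul (hφ.continuous.comp hline)).add
        (hac.mul ((hdφ.comp hline).clm_apply continuous_const))
    have hout : ∀ r : ℝ, R < r → a' r * φ (r • (σ : E3)) +
        a r * fderiv ℝ φ (r • (σ : E3)) σ = 0 := fun r hr => by
      have h1 : (fun r : ℝ => a r * φ (r • (σ : E3))) =ᶠ[𝓝 r] fun _ => 0 := by
        filter_upwards [lt_mem_nhds hr] with s hs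
        rw [hφ0 _ (by rw [norm_smul, hσ, mul_one]; exact hs.le.trans (le_abs_self s)), mul_zero]
      exact (hd r).unique ((hasDerivAt_const r (0 : ℂ)).congr_of_eventuallyEq h1)
    have hii : IntegrableOn (fun r : ℝ =>
        a' r * φ (r • (σ : E3)) + a r * fderiv ℝ φ (r • (σ : E3)) σ) (Set.Ioi 0) := by
      have : IntegrableOn (fun r : ℝ =>
          a' r * φ (r • (σ : E3)) + a r * fderiv ℝ φ (r • (σ : E3)) σ) (Set.Icc 0 R) :=
        hcont.continuousOn.integrableOn_Icc
      refine this.of_forall_sdiff_eq_zero measurableSet_Ioi fun r hr => ?_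
      refine hout r ?_
      by_contra h
      exact hr.2 ⟨le_of_lt hr.1, not_lt.1 h⟩
    have hlim : Tendsto (fun r : ℝ => a r * φ (r • (σ : E3))) atTop (𝓝 0) := by
      refine tendsto_const_nhds.congr' ?_
      filter_upwards [eventually_ge_atTop R] with r hr
      rw [hφ0 _ (by rw [norm_smul, hσ, mul_one]; exact hr.trans (le_abs_self r)), mul_zero]
    have hmain := integral_Ioi_of_hasDerivAt_of_tendsto (a := 0)
      (hd 0).continuousAt.continuousWithinAt (fun r _ => hd r) hii hlim
    simp only [zero_smul, zero_sub] at hmain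
    rw [← hmain]
    refine setIntegral_congr_fun measurableSet_Ioi fun r hr => ?_
    have hr0 : (0 : ℝ) < r := hr
    have hn : ‖r • (σ : E3)‖ = r := by rw [norm_smul, hσ, mul_one, Real.norm_of_nonneg hr0.le]
    simp only [hn]
    rw [smul_smul, inv_mul_cancel₀ hr0.ne', one_smul, mul_div_cancel₀ _ (by
      simpa using hr0.ne')]
    ring
  simp_rw [hinner]
  rw [integral_const, toSphere_real_univ_E3, Complex.real_smul]
  push_cast
  ring

/-! ### Partial derivatives -/

theorem ContDiffOn.pderiv3 {f : E3 → ℂ} (hf : ContDiffOn ℝ ∞ f {0}ᶜ) (i : Fin 3) :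
    ContDiffOn ℝ ∞ (pderiv3 i f) {0}ᶜ :=
  (hf.fderiv_of_isOpen isOpen_compl_singleton (m := ∞) (by simp)).clm_apply contDiffOn_const

theorem ContDiff.pderiv3 {f : E3 → ℂ} (hf : ContDiff ℝ ∞ f) (i : Fin 3) :
    ContDiff ℝ ∞ (pderiv3 i f) :=
  (hf.fderiv_right (m := ∞) (by simp)).clm_apply contDiff_const

theorem HasCompactSupport.pderiv3 {f : E3 → ℂ} (hf : HasCompactSupport f) (i : Fin 3) :
    HasCompactSupport (pderiv3 i f) :=
  hf.fderiv_apply ℝ _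

theorem pderiv3_comm {f : E3 → ℂ} (hf : ContDiff ℝ ∞ f) (i j : Fin 3) :
    pderiv3 i (pderiv3 j f) = pderiv3 j (pderiv3 i f) := by
  funext x
  have hd : DifferentiableAt ℝ (fderiv ℝ f) x :=
    ((hf.fderiv_right (m := ∞) (by simp)).differentiable (by simp)) x
  have key : ∀ k l : Fin 3, pderiv3 k (pderiv3 l f) x =
      fderiv ℝ (fderiv ℝ f) x (EuclideanSpace.single k 1) (EuclideanSpace.single l 1) := by
    intro k l
    have h : HasFDerivAt (pderiv3 l f) _ x :=
      hd.hasFDerivAt.clm_apply (hasFDerivAt_const (EuclideanSpace.single l (1 : ℝ)) x)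
    rw [pderiv3, h.fderiv]
    simp
  rw [key, key]
  exact (hf.contDiffAt.isSymmSndFDerivAt (by simp; exact WithTop.coe_le_coe.2 le_top)) _ _

theorem fderiv_apply_eq_sum_pderiv3 (f : E3 → ℂ) (x v : E3) :
    fderiv ℝ f x v = ∑ i, (v i : ℂ) * pderiv3 i f x := by
  have hv : v = ∑ i, v i • EuclideanSpace.single i (1 : ℝ) := by
    ext j
    simp [Fin.sum_univ_three, PiLp.single_apply]
    fin_cases j <;> simp
  conv_lhs => rw [hv]
  simp [pderiv3, Complex.real_smul]

theorem quadOp_tensorSq_vecD1 (a b : Fin 3) (f : E3 → ℂ) (x : E3) :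
    quadOp (toC (tensorSq vecD1 a b)) f x = pderiv3 a (pderiv3 b f) x := by
  fin_cases a <;> fin_cases b <;>
    simp [quadOp, toC, tensorSq, vecD1, Fin.sum_univ_three]

theorem quadOp_normSqM_vecD1 (f : E3 → ℂ) (x : E3) :
    quadOp (toC (normSqM vecD1)) f x = ∑ i, pderiv3 i (pderiv3 i f) x := by
  simp [quadOp, toC, normSqM, tensorSq, vecD1, Fin.sum_univ_three]

theorem quadOp_normSqM_vecD2 (f : E3 → ℂ) (x : E3) :
    quadOp (toC (normSqM vecD2)) f x = pderiv3 0 (pderiv3 0 f) x + pderiv3 1 (pderiv3 1 f) x := by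
  simp [quadOp, toC, normSqM, tensorSq, vecD2, Fin.sum_univ_three]

theorem quadSymbol_normSqM_vecD1 (n : E3) : quadSymbol (normSqM vecD1) n = ‖n‖ ^ 2 := by
  rw [EuclideanSpace.norm_sq_eq]
  simp [quadSymbol, normSqM, tensorSq, vecD1, Fin.sum_univ_three]
  ring

theorem quadSymbol_normSqM_vecD2 (n : E3) :
    quadSymbol (normSqM vecD2) n = n 0 ^ 2 + n 1 ^ 2 := by
  simp [quadSymbol, normSqM, tensorSq, vecD2, Fin.sum_univ_three]
  ring

/-! ### Radial functions -/

theorem hasFDerivAt_norm_E3 {x : E3} (hx : x ≠ 0) :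
    HasFDerivAt (fun y : E3 => ‖y‖) (‖x‖⁻¹ • innerSL ℝ x) x := by
  have h := (hasStrictFDerivAt_norm_sq x).hasFDerivAt.sqrt (by simpa using hx)
  simp only [Real.sqrt_sq (norm_nonneg _)] at h
  refine h.congr_fderiv ?_
  ext v
  simp
  ring

theorem inner_single_one_E3 (x : E3) (i : Fin 3) :
    inner ℝ x (EuclideanSpace.single i (1 : ℝ)) = x i := by
  simp [EuclideanSpace.inner_single_right]

theorem ofReal_proj_single_E3 (i j : Fin 3) :
    (((EuclideanSpace.proj j : E3 →L[ℝ] ℝ) (EuclideanSpace.single i 1) : ℝ) : ℂ) =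
      (1 : Matrix (Fin 3) (Fin 3) ℂ) i j := by
  change (((EuclideanSpace.single i (1 : ℝ) : E3) j : ℝ) : ℂ) = _
  rw [PiLp.single_apply, Matrix.one_apply]
  by_cases h : j = i
  · simp [h]
  · simp [h, Ne.symm h]

section Radial

variable {f : E3 → ℂ} {u u' u'' : ℝ → ℂ}

/-- Agreement with `u ‖x‖` is asked only off the origin, so the value assigned at the singular point
never matters. -/
theorem hasFDerivAt_of_radial (hf : ∀ x, x ≠ 0 → f x = u ‖x‖) {x : E3} (hx : x ≠ 0) {w : ℂ}
    (hu : HasDerivAt u w ‖x‖) :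
    HasFDerivAt f ((‖x‖⁻¹ • innerSL ℝ x : E3 →L[ℝ] ℝ).smulRight w) x := by
  have h := hu.hasFDerivAt.comp x (hasFDerivAt_norm_E3 hx)
  refine (h.congr_of_eventuallyEq ?_).congr_fderiv ?_
  · filter_upwards [isOpen_compl_singleton.mem_nhds hx] with y hy using hf y hy
  · ext v
    simp [mul_assoc]

theorem pderiv3_of_radial (hf : ∀ x, x ≠ 0 → f x = u ‖x‖)
    (hu : ∀ r, 0 < r → HasDerivAt u (u' r) r) {x : E3} (hx : x ≠ 0) (i : Fin 3) :
    pderiv3 i f x = u' ‖x‖ / ‖x‖ * x i := by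
  have hn : 0 < ‖x‖ := norm_pos_iff.2 hx
  rw [pderiv3, (hasFDerivAt_of_radial hf hx (hu _ hn)).fderiv]
  simp [Complex.real_smul, inner_single_one_E3]
  ring

theorem pderiv3_pderiv3_of_radial (hf : ∀ x, x ≠ 0 → f x = u ‖x‖)
    (hu : ∀ r, 0 < r → HasDerivAt u (u' r) r) (hu' : ∀ r, 0 < r → HasDerivAt u' (u'' r) r)
    {x : E3} (hx : x ≠ 0) (i j : Fin 3) :
    pderiv3 i (pderiv3 j f) x =
      (u'' ‖x‖ / ‖x‖ ^ 2 - u' ‖x‖ / ‖x‖ ^ 3) * x i * x j +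
        u' ‖x‖ / ‖x‖ * (1 : Matrix (Fin 3) (Fin 3) ℂ) i j := by
  have hn : 0 < ‖x‖ := norm_pos_iff.2 hx
  have hnC : (‖x‖ : ℂ) ≠ 0 := by exact_mod_cast hn.ne'
  have hv : HasDerivAt (fun r : ℝ => u' r / r)
      ((u'' ‖x‖ * ‖x‖ - u' ‖x‖ * (1 : ℝ)) / (‖x‖ : ℂ) ^ 2) ‖x‖ :=
    (hu' _ hn).div (hasDerivAt_id _).ofReal_comp hnC
  have h1 := hasFDerivAt_of_radial (f := fun y => u' ‖y‖ / ‖y‖) (fun _ _ => rfl) hx hv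
  have h2 : HasFDerivAt (fun y : E3 => ((y j : ℝ) : ℂ))
      (Complex.ofRealCLM.comp (EuclideanSpace.proj j : E3 →L[ℝ] ℝ)) x :=
    (Complex.ofRealCLM.comp (EuclideanSpace.proj j : E3 →L[ℝ] ℝ)).hasFDerivAt
  have h3 := (h1.mul h2).congr_of_eventuallyEq (f₁ := pderiv3 j f) (by
    filter_upwards [isOpen_compl_singleton.mem_nhds hx] with y hy
    exact pderiv3_of_radial hf hu hy j)
  rw [pderiv3, h3.fderiv]
  have hij := ofReal_proj_single_E3 i j
  simp only [add_apply, smul_apply, ContinuousLinearMap.comp_apply,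
    ContinuousLinearMap.smulRight_apply, innerSL_apply_apply, inner_single_one_E3,
    Complex.ofRealCLM_apply, hij, smul_eq_mul, Complex.real_smul]
  push_cast
  field_simp
  ring

theorem sum_pderiv3_pderiv3_of_radial (hf : ∀ x, x ≠ 0 → f x = u ‖x‖)
    (hu : ∀ r, 0 < r → HasDerivAt u (u' r) r) (hu' : ∀ r, 0 < r → HasDerivAt u' (u'' r) r)
    {x : E3} (hx : x ≠ 0) :
    ∑ i, pderiv3 i (pderiv3 i f) x = u'' ‖x‖ + 2 * u' ‖x‖ / ‖x‖ := by
  have hn : 0 < ‖x‖ := norm_pos_iff.2 hx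
  have hnC : (‖x‖ : ℂ) ≠ 0 := by exact_mod_cast hn.ne'
  have hsq : (‖x‖ : ℂ) ^ 2 = (x 0 : ℂ) ^ 2 + (x 1 : ℂ) ^ 2 + (x 2 : ℂ) ^ 2 := by
    have := EuclideanSpace.norm_sq_eq x
    simp only [Fin.sum_univ_three, Real.norm_eq_abs, sq_abs] at this
    exact_mod_cast this
  simp only [pderiv3_pderiv3_of_radial hf hu hu' hx, Fin.sum_univ_three, Matrix.one_apply_eq]
  have : u'' ‖x‖ + 2 * u' ‖x‖ / ‖x‖ =
      (u'' ‖x‖ / ‖x‖ ^ 2 - u' ‖x‖ / ‖x‖ ^ 3) * (‖x‖ : ℂ) ^ 2 + 3 * (u' ‖x‖ / ‖x‖) := by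
    field_simp
    ring
  rw [this, hsq]
  ring

end Radial

/-! ### The potential of the Laplacian for a radial source -/

/-- Here `c` is the continuous extension to `0` of `s² g(s)`. Symmetry makes the potential radial,
and the flux `r² u'` is a primitive of `c` with limit zero at the origin. Hence `u'`, and through
the equation `u''`, is known, and these two determine the Hessian. -/
theorem IsPotential.pderiv3_pderiv3_eq {f Ψ : E3 → ℂ} {g c : ℝ → ℂ} (hf : ∀ x, x ≠ 0 → f x = g ‖x‖)
    (hc : Continuous c) (hgc : ∀ s : ℝ, 0 < s → (s : ℂ) ^ 2 * g s = c s)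
    (h : IsPotential (normSqM vecD1) f Ψ) {x : E3} (hx : x ≠ 0) (i j : Fin 3) :
    pderiv3 i (pderiv3 j Ψ) x = g ‖x‖ * (x i / ‖x‖) * (x j / ‖x‖) +
      (∫ s in (0 : ℝ)..‖x‖, c s) / ‖x‖ ^ 3 *
        ((1 : Matrix (Fin 3) (Fin 3) ℂ) i j - 3 * ((x i / ‖x‖) * (x j / ‖x‖))) := by
  obtain ⟨hsm, heq, ⟨B, hB⟩, hsymm⟩ := h
  set e : E3 := EuclideanSpace.single 0 1 with he
  have hen : ‖e‖ = 1 := by simp [he]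
  have hfU : ∀ (U : E3 ≃ₗᵢ[ℝ] E3) (x : E3), f (U x) = f x := by
    intro U x
    by_cases hx : x = 0
    · simp [hx]
    · rw [hf x hx, hf _ (by simpa using hx), U.norm_map]
  set u : ℝ → ℂ := fun r => Ψ (r • e) with hu
  have hline : ContDiff ℝ ∞ fun r : ℝ => r • e := by fun_prop
  have husm : ContDiffOn ℝ ∞ u (Set.Ioi 0) := by
    refine hsm.comp hline.contDiffOn fun r hr => ?_
    have : r ≠ 0 := ne_of_gt hr
    simpa [he] using this
  have hu1sm : ContDiffOn ℝ ∞ (deriv u) (Set.Ioi 0) :=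
    ((contDiffOn_infty_iff_deriv_of_isOpen isOpen_Ioi).1 husm).2
  have hd : ∀ r, 0 < r → HasDerivAt u (deriv u r) r := fun r hr =>
    ((husm.differentiableOn (by simp)).differentiableAt (isOpen_Ioi.mem_nhds hr)).hasDerivAt
  have hd' : ∀ r, 0 < r → HasDerivAt (deriv u) (deriv (deriv u) r) r := fun r hr =>
    ((hu1sm.differentiableOn (by simp)).differentiableAt (isOpen_Ioi.mem_nhds hr)).hasDerivAt
  -- The reflection exchanging `y` and `‖y‖ e` preserves the Laplacian and the source, so it
  -- preserves `Ψ`.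
  have hrad : ∀ y, y ≠ 0 → Ψ y = u ‖y‖ := by
    intro y _
    have hn : ‖y‖ = ‖‖y‖ • e‖ := by rw [norm_smul, hen, mul_one, norm_norm]
    have := hsymm (Submodule.reflection (Submodule.span ℝ {y - ‖y‖ • e})ᗮ)
      (fun n => by simp [quadSymbol_normSqM_vecD1]) (hfU _) y
    rw [Submodule.reflection_sub hn] at this
    exact this.symm
  have hode : ∀ r : ℝ, 0 < r → deriv (deriv u) r + 2 * deriv u r / r = g r := by
    intro r hr
    have hne : r • e ≠ 0 := by simpa [he] using hr.ne'
    have hnr : ‖r • e‖ = r := by rw [norm_smul, hen, mul_one, Real.norm_of_nonneg hr.le]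
    have := heq _ hne
    rw [quadOp_normSqM_vecD1, sum_pderiv3_pderiv3_of_radial hrad hd hd' hne, hf _ hne, hnr] at this
    exact this
  have hw : ∀ r : ℝ, 0 < r → HasDerivAt (fun r : ℝ => (r : ℂ) ^ 2 * deriv u r) (c r) r := by
    intro r hr
    have hrC : (r : ℂ) ≠ 0 := by exact_mod_cast hr.ne'
    have h1 : HasDerivAt (fun r : ℝ => (r : ℂ)) 1 r := Complex.ofRealCLM.hasDerivAt
    refine ((h1.pow 2).mul (hd' r hr)).congr_deriv ?_
    rw [← hgc r hr, ← hode r hr]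
    field_simp
    simp
    ring
  have hbd : ∀ᶠ r : ℝ in 𝓝[>] 0, ‖deriv u r‖ ≤ B := by
    have ht : Tendsto (fun r : ℝ => r • e) (𝓝[>] 0) (𝓝[≠] (0 : E3)) := by
      refine tendsto_nhdsWithin_iff.2 ⟨?_, ?_⟩
      · have : Tendsto (fun r : ℝ => r • e) (𝓝 0) (𝓝 ((0 : ℝ) • e)) := by
          exact (continuous_id.smul continuous_const).tendsto 0
        rw [zero_smul] at this
        exact this.mono_left nhdsWithin_le_nhds
      · filter_upwards [self_mem_nhdsWithin] with r hr
        have : r ≠ 0 := ne_of_gt hr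
        simpa [he] using this
    filter_upwards [ht.eventually hB, self_mem_nhdsWithin] with r hr hr0
    have hne : r • e ≠ 0 := by
      have : r ≠ 0 := ne_of_gt hr0
      simpa [he] using this
    have hdΨ : DifferentiableAt ℝ Ψ (r • e) :=
      (hsm.differentiableOn (by simp)).differentiableAt (isOpen_compl_singleton.mem_nhds hne)
    have h1 : HasDerivAt u (fderiv ℝ Ψ (r • e) e) r := by
      refine hdΨ.hasFDerivAt.comp_hasDerivAt r ?_
      simpa using (hasDerivAt_id r).smul_const e
    rw [h1.deriv]
    exact (ContinuousLinearMap.le_of_opNorm_le _ hr e).trans (by rw [hen, mul_one])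
  -- The bounded gradient enters here: it excludes a multiple of the homogeneous solution `1/r`.
  have hw0 : Tendsto (fun r : ℝ => (r : ℂ) ^ 2 * deriv u r) (𝓝[>] 0) (𝓝 0) := by
    have h1 : Tendsto (fun r : ℝ => (r : ℂ) ^ 2) (𝓝[>] 0) (𝓝 0) := by
      have : Continuous fun r : ℝ => (r : ℂ) ^ 2 := by fun_prop
      simpa using (this.tendsto 0).mono_left nhdsWithin_le_nhds
    exact h1.zero_mul_isBoundedUnder_le (isBoundedUnder_of_eventually_le hbd)
  have hn : 0 < ‖x‖ := norm_pos_iff.2 hx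
  have hnC : (‖x‖ : ℂ) ≠ 0 := by exact_mod_cast hn.ne'
  have hint : ∫ s in (0 : ℝ)..‖x‖, c s = (‖x‖ : ℂ) ^ 2 * deriv u ‖x‖ := by
    have := intervalIntegral.integral_eq_sub_of_hasDerivAt_of_tendsto hn
      (fun r hr => hw r hr.1) (hc.intervalIntegrable _ _) hw0
      ((hw _ hn).continuousAt.tendsto.mono_left nhdsWithin_le_nhds)
    rw [this, sub_zero]
  rw [pderiv3_pderiv3_of_radial hrad hd hd' hx, hint, ← hode _ hn]
  field_simp
  ring

/-! ### The potential of the horizontal Laplacian for a vanishing source -/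

/-- Such a reflection fixes the third basis vector. Being an isometry as well, it is a symmetry of
the horizontal Laplacian. -/
theorem reflection_apply_two {v : E3} (hv : v 2 = 0) (n : E3) :
    (Submodule.reflection (Submodule.span ℝ {v})ᗮ n) 2 = n 2 := by
  set U := Submodule.reflection (Submodule.span ℝ {v})ᗮ
  have hmem : (EuclideanSpace.single 2 1 : E3) ∈ (Submodule.span ℝ {v})ᗮ := by
    rw [Submodule.mem_orthogonal_singleton_iff_inner_right, inner_single_one_E3, hv]
  have he : U (EuclideanSpace.single 2 1) = EuclideanSpace.single 2 1 :=
    Submodule.reflection_mem_subspace_eq_self hmem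
  rw [← inner_single_one_E3 (U n), ← inner_single_one_E3 n]
  conv_lhs => rw [← he]
  exact U.inner_map_map _ _

theorem quadSymbol_normSqM_vecD2_eq (n : E3) :
    quadSymbol (normSqM vecD2) n = ‖n‖ ^ 2 - n 2 ^ 2 := by
  rw [quadSymbol_normSqM_vecD2, EuclideanSpace.norm_sq_eq]
  simp [Fin.sum_univ_three]

section Horizontal

variable {f Ψ : E3 → ℂ}

theorem IsPotential.apply_eq_of_horizontal (hf : ∀ x, f x = 0)
    (h : IsPotential (normSqM vecD2) f Ψ) {x y : E3}
    (h01 : x 0 ^ 2 + x 1 ^ 2 = y 0 ^ 2 + y 1 ^ 2) (h2 : x 2 = y 2) : Ψ x = Ψ y := by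
  have hn : ‖x‖ = ‖y‖ := by
    rw [← sq_eq_sq₀ (norm_nonneg _) (norm_nonneg _)]
    simp only [EuclideanSpace.norm_sq_eq, Fin.sum_univ_three, Real.norm_eq_abs, sq_abs]
    rw [h01, h2]
  have hU := h.2.2.2 (Submodule.reflection (Submodule.span ℝ {x - y})ᗮ)
    (fun n => by
      rw [quadSymbol_normSqM_vecD2_eq, quadSymbol_normSqM_vecD2_eq, LinearIsometryEquiv.norm_map,
        reflection_apply_two (by simp [h2])])
    (fun z => by rw [hf, hf]) x
  rw [Submodule.reflection_sub hn] at hU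
  exact hU.symm

theorem ContDiffOn.differentiableAt_compl_zero {g : E3 → ℂ} (hg : ContDiffOn ℝ ∞ g {0}ᶜ) {x : E3}
    (hx : x ≠ 0) : DifferentiableAt ℝ g x :=
  (hg.differentiableOn (by simp)).differentiableAt (isOpen_compl_singleton.mem_nhds hx)

theorem IsPotential.rotation_eq_zero (hf : ∀ x, f x = 0)
    (h : IsPotential (normSqM vecD2) f Ψ) {x : E3} (hx : x ≠ 0) :
    (x 0 : ℂ) * pderiv3 1 Ψ x - x 1 * pderiv3 0 Ψ x = 0 := by
  -- The rotation of `x` about the third axis; `Ψ` is constant on this circle.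
  set γ : ℝ → E3 := fun t => Real.cos t • !₂[x 0, x 1, 0] +
    Real.sin t • !₂[-x 1, x 0, 0] + !₂[0, 0, x 2] with hγ
  have hγ0 : γ 0 = x := by
    ext i
    fin_cases i <;> simp [hγ]
  have hd : HasDerivAt γ (!₂[-x 1, x 0, 0] : E3) 0 := by
    have h1 := (Real.hasDerivAt_cos 0).smul_const (!₂[x 0, x 1, 0] : E3)
    have h2 := (Real.hasDerivAt_sin 0).smul_const (!₂[-x 1, x 0, 0] : E3)
    refine ((h1.add h2).add_const (!₂[0, 0, x 2] : E3)).congr_deriv ?_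
    simp
  have hc : (fun t => Ψ (γ t)) = fun _ => Ψ x := by
    funext t
    refine h.apply_eq_of_horizontal hf ?_ ?_
    · simp only [hγ, PiLp.add_apply, PiLp.smul_apply, smul_eq_mul]
      simp
      linear_combination (x 0 ^ 2 + x 1 ^ 2) * Real.sin_sq_add_cos_sq t
    · simp [hγ]
  have hΨ := (h.1.differentiableAt_compl_zero hx).hasFDerivAt
  rw [← hγ0] at hΨ
  have h1 := hΨ.comp_hasDerivAt 0 hd
  have h2 : HasDerivAt (fun t => Ψ (γ t)) 0 0 := by
    rw [hc]
    exact hasDerivAt_const _ _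
  have h3 := h1.unique h2
  rw [hγ0, fderiv_apply_eq_sum_pderiv3, Fin.sum_univ_three] at h3
  simp at h3
  linear_combination h3

theorem pderiv3_coord_mul {g : E3 → ℂ} {x : E3} (hg : DifferentiableAt ℝ g x) (i j : Fin 3) :
    pderiv3 i (fun y : E3 => (y j : ℂ) * g y) x =
      (1 : Matrix (Fin 3) (Fin 3) ℂ) i j * g x + x j * pderiv3 i g x := by
  have h2 : HasFDerivAt (fun y : E3 => ((y j : ℝ) : ℂ))
      (Complex.ofRealCLM.comp (EuclideanSpace.proj j : E3 →L[ℝ] ℝ)) x :=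
    (Complex.ofRealCLM.comp (EuclideanSpace.proj j : E3 →L[ℝ] ℝ)).hasFDerivAt
  have h3 : HasFDerivAt (fun y : E3 => (y j : ℂ) * g y) _ x := h2.mul hg.hasFDerivAt
  rw [pderiv3, h3.fderiv]
  simp only [add_apply, smul_apply, ContinuousLinearMap.comp_apply,
    Complex.ofRealCLM_apply, ofReal_proj_single_E3, smul_eq_mul, pderiv3]
  ring

theorem IsPotential.pderiv3_rotation (hf : ∀ x, f x = 0)
    (h : IsPotential (normSqM vecD2) f Ψ) {x : E3} (hx : x ≠ 0) (i : Fin 3) :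
    (1 : Matrix (Fin 3) (Fin 3) ℂ) i 0 * pderiv3 1 Ψ x + x 0 * pderiv3 i (pderiv3 1 Ψ) x =
      (1 : Matrix (Fin 3) (Fin 3) ℂ) i 1 * pderiv3 0 Ψ x + x 1 * pderiv3 i (pderiv3 0 Ψ) x := by
  rw [← pderiv3_coord_mul ((h.1.pderiv3 1).differentiableAt_compl_zero hx),
    ← pderiv3_coord_mul ((h.1.pderiv3 0).differentiableAt_compl_zero hx)]
  have he : (fun y : E3 => (y 0 : ℂ) * pderiv3 1 Ψ y) =ᶠ[𝓝 x]
      fun y : E3 => (y 1 : ℂ) * pderiv3 0 Ψ y := by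
    filter_upwards [isOpen_compl_singleton.mem_nhds hx] with y hy
    exact sub_eq_zero.1 (h.rotation_eq_zero hf hy)
  rw [pderiv3, he.fderiv_eq, pderiv3]

/-- With `R` the distance to the axis, `R∂_R(R∂_R Ψ) = R²(∂₁² + ∂₂²)Ψ - ∂_θ²Ψ = 0`. So `R∂_R Ψ` is
constant along the horizontal segment from the axis to `x`. It vanishes on the axis, where `Ψ` is
smooth because `x 2 ≠ 0`. -/
theorem IsPotential.euler_eq_zero (hf : ∀ x, f x = 0)
    (h : IsPotential (normSqM vecD2) f Ψ) {x : E3} (hx : x 2 ≠ 0) :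
    (x 0 : ℂ) * pderiv3 0 Ψ x + x 1 * pderiv3 1 Ψ x = 0 := by
  set p : E3 := !₂[x 0, x 1, 0] with hp
  set γ : ℝ → E3 := fun s => s • p + !₂[0, 0, x 2] with hγ
  have hγ1 : γ 1 = x := by
    ext i
    fin_cases i <;> simp [hγ, hp]
  have hγv : ∀ s, γ s 0 = s * x 0 ∧ γ s 1 = s * x 1 ∧ γ s 2 = x 2 := by
    intro s
    simp [hγ, hp]
  have hγ0 : ∀ s, γ s ≠ 0 := fun s hs => hx (by rw [← (hγv s).2.2, hs]; simp)
  have hd : ∀ s, HasDerivAt γ p s := fun s => by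
    refine (((hasDerivAt_id s).smul_const p).add_const (!₂[0, 0, x 2] : E3)).congr_deriv ?_
    simp
  have hg : ∀ (i : Fin 3) (s : ℝ), HasDerivAt (fun s => pderiv3 i Ψ (γ s))
      (x 0 * pderiv3 0 (pderiv3 i Ψ) (γ s) + x 1 * pderiv3 1 (pderiv3 i Ψ) (γ s)) s := by
    intro i s
    have h1 := (((h.1.pderiv3 i).differentiableAt_compl_zero (hγ0 s)).hasFDerivAt).comp_hasDerivAt
      s (hd s)
    refine h1.congr_deriv ?_
    rw [fderiv_apply_eq_sum_pderiv3, Fin.sum_univ_three]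
    simp [hp]
  have hk : ∀ s : ℝ, HasDerivAt (fun s : ℝ => (s : ℂ) *
      (x 0 * pderiv3 0 Ψ (γ s) + x 1 * pderiv3 1 Ψ (γ s))) _ s := fun s =>
    (Complex.ofRealCLM.hasDerivAt (x := s)).mul
      (((hg 0 s).const_mul (x 0 : ℂ)).add ((hg 1 s).const_mul (x 1 : ℂ)))
  have hk0 : ∀ s ∈ Set.Ioo (0 : ℝ) 1, HasDerivAt (fun s : ℝ => (s : ℂ) *
      (x 0 * pderiv3 0 Ψ (γ s) + x 1 * pderiv3 1 Ψ (γ s))) ((fun _ => (0 : ℂ)) s) s := by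
    intro s hs
    have hsC : (s : ℂ) ≠ 0 := by exact_mod_cast hs.1.ne'
    refine (hk s).congr_deriv ?_
    have r0 := h.pderiv3_rotation hf (hγ0 s) 0
    have r1 := h.pderiv3_rotation hf (hγ0 s) 1
    have l := h.2.1 _ (hγ0 s)
    rw [quadOp_normSqM_vecD2, hf] at l
    rw [(hγv s).1, (hγv s).2.1] at r0 r1
    simp at r0 r1
    -- The factor `s` turns the derivative into `R∂_R(R∂_R Ψ)` at `γ s`, so that the differentiated
    -- rotation identities cancel the first-order and mixed terms.
    apply mul_left_cancel₀ hsC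
    simp only [Complex.ofRealCLM_apply, Complex.ofReal_one, one_mul, mul_zero]
    linear_combination (s : ℂ) * x 1 * r0 - (s : ℂ) * x 0 * r1 +
      ((s : ℂ) ^ 2 * x 0 ^ 2 + (s : ℂ) ^ 2 * x 1 ^ 2) * l
  have hint := intervalIntegral.integral_eq_sub_of_hasDerivAt_of_le zero_le_one
    (fun s _ => (hk s).continuousAt.continuousWithinAt) hk0 (by simp)
  simp [hγ1] at hint
  exact hint.symm

/-- The angular and radial identities form a linear system for the horizontal gradient with
determinant `x₁² + x₂²`. Asking `x 0 ≠ 0` keeps the point off the axis and still leaves a dense set.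
-/
theorem IsPotential.pderiv3_horizontal_eq_zero (hf : ∀ x, f x = 0)
    (h : IsPotential (normSqM vecD2) f Ψ) {x : E3} (hx0 : x 0 ≠ 0) (hx : x 2 ≠ 0) :
    pderiv3 0 Ψ x = 0 ∧ pderiv3 1 Ψ x = 0 := by
  have hR := h.rotation_eq_zero hf (x := x) (fun h0 => hx (by simp [h0]))
  have hE := h.euler_eq_zero hf hx
  have hpos : (x 0 : ℂ) ^ 2 + (x 1 : ℂ) ^ 2 ≠ 0 := by
    have : x 0 ^ 2 + x 1 ^ 2 ≠ 0 := by positivity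
    rw [← Complex.ofReal_pow, ← Complex.ofReal_pow, ← Complex.ofReal_add]
    exact Complex.ofReal_ne_zero.2 this
  refine ⟨mul_left_cancel₀ hpos ?_, mul_left_cancel₀ hpos ?_⟩
  · linear_combination (x 0 : ℂ) * hE - x 1 * hR
  · linear_combination (x 1 : ℂ) * hE + x 0 * hR

theorem IsPotential.pderiv3_pderiv3_horizontal_eq_zero (hf : ∀ x, f x = 0)
    (h : IsPotential (normSqM vecD2) f Ψ) {x : E3} (hx : x ≠ 0) (i : Fin 3) :
    pderiv3 i (pderiv3 0 Ψ) x = 0 ∧ pderiv3 i (pderiv3 1 Ψ) x = 0 := by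
  have hgen : ∀ g : E3 → ℂ, ContDiffOn ℝ ∞ g {0}ᶜ →
      (∀ y : E3, y 0 ≠ 0 → y 2 ≠ 0 → g y = 0) → pderiv3 i g x = 0 := by
    intro g hg hz
    have hz' : ∀ y : E3, y 0 ≠ 0 → y 2 ≠ 0 → pderiv3 i g y = 0 := by
      intro y hy0 hy2
      have c0 : Continuous fun z : E3 => z 0 := by fun_prop
      have c2 : Continuous fun z : E3 => z 2 := by fun_prop
      have he : g =ᶠ[𝓝 y] fun _ => 0 := by
        filter_upwards [c0.continuousAt.eventually_ne hy0, c2.continuousAt.eventually_ne hy2]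
          with z hz0 hz2 using hz z hz0 hz2
      rw [pderiv3, he.fderiv_eq]
      simp
    -- Moving along `q` leaves both planes `x 0 = 0` and `x 2 = 0` for all small nonzero `t`, so
    -- continuity extends the vanishing to every `x ≠ 0`.
    set q : E3 := !₂[1, 0, 1] with hq
    have hc : Tendsto (fun t : ℝ => pderiv3 i g (x + t • q)) (𝓝[≠] 0) (𝓝 (pderiv3 i g x)) := by
      have h1 : ContinuousAt (pderiv3 i g) (x + (0 : ℝ) • q) := by
        rw [zero_smul, add_zero]
        exact ((hg.pderiv3 i).differentiableAt_compl_zero hx).continuousAt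
      have h2 : ContinuousAt (fun t : ℝ => x + t • q) 0 := by fun_prop
      have h3 := (ContinuousAt.comp (f := fun t : ℝ => x + t • q) h1 h2).tendsto
      simp only [Function.comp_def, zero_smul, add_zero] at h3
      exact h3.mono_left nhdsWithin_le_nhds
    refine tendsto_nhds_unique hc (tendsto_const_nhds.congr' ?_)
    have hne : ∀ a : ℝ, ∀ᶠ t : ℝ in 𝓝[≠] 0, a + t ≠ 0 := by
      intro a
      by_cases ha : a = 0
      · filter_upwards [self_mem_nhdsWithin] with t ht
        simpa [ha] using ht
      · have : ContinuousAt (fun t : ℝ => a + t) 0 := by fun_prop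
        exact (this.eventually_ne (by simpa using ha)).filter_mono nhdsWithin_le_nhds
    filter_upwards [hne (x 0), hne (x 2)] with t h0 h2
    exact (hz' _ (by simpa [hq] using h0) (by simpa [hq] using h2)).symm
  exact ⟨hgen _ (h.1.pderiv3 0) fun y h0 h2 => (h.pderiv3_horizontal_eq_zero hf h0 h2).1,
    hgen _ (h.1.pderiv3 1) fun y h0 h2 => (h.pderiv3_horizontal_eq_zero hf h0 h2).2⟩

theorem IsPotential.quadOp_tensorSq_vecD2_eq_zero (hf : ∀ x, f x = 0)
    (h : IsPotential (normSqM vecD2) f Ψ) {x : E3} (hx : x ≠ 0) (a b : Fin 3) :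
    quadOp (toC (tensorSq vecD2 a b)) Ψ x = 0 := by
  have h' := fun i => h.pderiv3_pderiv3_horizontal_eq_zero hf hx i
  fin_cases a <;> fin_cases b <;>
    simp [quadOp, toC, tensorSq, vecD2, Fin.sum_univ_three, h']

end Horizontal

theorem isPotential_zero (M : Matrix (Fin 3) (Fin 3) ℝ) {f : E3 → ℂ} (hf : ∀ x, f x = 0) :
    IsPotential M f (fun _ => 0) := by
  have h0 : ∀ i, pderiv3 i (fun _ : E3 => (0 : ℂ)) = fun _ => 0 := by
    intro i
    funext x
    simp [pderiv3]
  exact ⟨contDiffOn_const, fun x _ => by simp [quadOp, h0, hf], ⟨0, by simp⟩, fun _ _ _ _ => rfl⟩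

/-! ### Local integrability of radial functions and their derivatives -/

section Radial

variable {f : E3 → ℂ} {u u' u'' : ℝ → ℂ}

theorem contDiffOn_comp_norm (hu : ContDiffOn ℝ ∞ u (Set.Ioi 0)) :
    ContDiffOn ℝ ∞ (fun x : E3 => u ‖x‖) {0}ᶜ :=
  hu.comp (contDiffOn_id.norm ℝ fun _ hx => hx) fun _ hx => norm_pos_iff.2 hx

theorem locallyIntegrable_of_radial (hfs : ContDiffOn ℝ ∞ f {0}ᶜ)
    (hf : ∀ x, x ≠ 0 → f x = u ‖x‖)
    (hb : ∀ R : ℝ, ∃ C : ℝ, ∀ r, 0 < r → r ≤ R → r ^ 2 * ‖u r‖ ≤ C) :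
    LocallyIntegrable f volume := by
  refine locallyIntegrable_of_norm_sq_mul_norm_le hfs.continuousOn fun R => ?_
  obtain ⟨C, hC⟩ := hb R
  exact ⟨C, fun x hx hxR => by rw [hf x hx]; exact hC _ (norm_pos_iff.2 hx) hxR⟩

theorem norm_coord_div_norm_le (x : E3) (i : Fin 3) : ‖((x i : ℂ)) / ‖x‖‖ ≤ 1 := by
  rw [norm_div, Complex.norm_real, Complex.norm_real, norm_norm]
  exact div_le_one_of_le₀ (PiLp.norm_apply_le x i) (norm_nonneg _)

theorem locallyIntegrable_pderiv3_of_radial (hfs : ContDiffOn ℝ ∞ f {0}ᶜ)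
    (hf : ∀ x, x ≠ 0 → f x = u ‖x‖) (hu : ∀ r, 0 < r → HasDerivAt u (u' r) r)
    (hb : ∀ R : ℝ, ∃ C : ℝ, ∀ r, 0 < r → r ≤ R → r ^ 2 * ‖u' r‖ ≤ C) (i : Fin 3) :
    LocallyIntegrable (pderiv3 i f) volume := by
  refine locallyIntegrable_of_norm_sq_mul_norm_le (hfs.pderiv3 i).continuousOn fun R => ?_
  obtain ⟨C, hC⟩ := hb R
  refine ⟨C, fun x hx hxR => le_trans ?_ (hC _ (norm_pos_iff.2 hx) hxR)⟩
  rw [pderiv3_of_radial hf hu hx, div_mul_eq_mul_div, mul_div_assoc, norm_mul]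
  gcongr
  exact mul_le_of_le_one_right (norm_nonneg _) (norm_coord_div_norm_le x i)

/-- The Hessian is `u'' r̂⊗r̂ + (u'/r)(I - r̂⊗r̂)`, so `r²` times it is controlled by `r² u''` and
`r u'`. -/
theorem locallyIntegrable_pderiv3_pderiv3_of_radial (hfs : ContDiffOn ℝ ∞ f {0}ᶜ)
    (hf : ∀ x, x ≠ 0 → f x = u ‖x‖) (hu : ∀ r, 0 < r → HasDerivAt u (u' r) r)
    (hu' : ∀ r, 0 < r → HasDerivAt u' (u'' r) r)
    (hb : ∀ R : ℝ, ∃ C : ℝ, ∀ r, 0 < r → r ≤ R → r * ‖u' r‖ ≤ C)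
    (hb' : ∀ R : ℝ, ∃ C : ℝ, ∀ r, 0 < r → r ≤ R → r ^ 2 * ‖u'' r‖ ≤ C) (i j : Fin 3) :
    LocallyIntegrable (pderiv3 i (pderiv3 j f)) volume := by
  refine locallyIntegrable_of_norm_sq_mul_norm_le ((hfs.pderiv3 j).pderiv3 i).continuousOn
    fun R => ?_
  obtain ⟨C, hC⟩ := hb R
  obtain ⟨C', hC'⟩ := hb' R
  refine ⟨C' + C + C, fun x hx hxR => ?_⟩
  have hn : 0 < ‖x‖ := norm_pos_iff.2 hx
  have hnC : (‖x‖ : ℂ) ≠ 0 := by exact_mod_cast hn.ne'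
  have h1 : ‖(1 : Matrix (Fin 3) (Fin 3) ℂ) i j‖ ≤ 1 := by
    rw [Matrix.one_apply]
    split_ifs <;> simp
  have hij : ‖((x i : ℂ) / ‖x‖) * ((x j : ℂ) / ‖x‖)‖ ≤ 1 := by
    rw [norm_mul]
    exact mul_le_one₀ (norm_coord_div_norm_le x i) (norm_nonneg _) (norm_coord_div_norm_le x j)
  have he : (‖x‖ : ℂ) ^ 2 * pderiv3 i (pderiv3 j f) x =
      (‖x‖ ^ 2 * u'' ‖x‖) * (((x i : ℂ) / ‖x‖) * ((x j : ℂ) / ‖x‖)) -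
        (‖x‖ * u' ‖x‖) * (((x i : ℂ) / ‖x‖) * ((x j : ℂ) / ‖x‖)) +
        (‖x‖ * u' ‖x‖) * (1 : Matrix (Fin 3) (Fin 3) ℂ) i j := by
    rw [pderiv3_pderiv3_of_radial hf hu hu' hx]
    field_simp
  have hl : ‖x‖ ^ 2 * ‖pderiv3 i (pderiv3 j f) x‖ =
      ‖(‖x‖ : ℂ) ^ 2 * pderiv3 i (pderiv3 j f) x‖ := by
    simp
  rw [hl, he]
  have b1 : ‖(‖x‖ : ℂ) * u' ‖x‖‖ ≤ C := by simpa using hC _ hn hxR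
  have b2 : ‖(‖x‖ : ℂ) ^ 2 * u'' ‖x‖‖ ≤ C' := by simpa using hC' _ hn hxR
  refine (norm_add_le _ _).trans (add_le_add ((norm_sub_le _ _).trans (add_le_add ?_ ?_)) ?_)
  · rw [norm_mul]
    exact (mul_le_of_le_one_right (norm_nonneg _) hij).trans b2
  · rw [norm_mul]
    exact (mul_le_of_le_one_right (norm_nonneg _) hij).trans b1
  · rw [norm_mul]
    exact (mul_le_of_le_one_right (norm_nonneg _) h1).trans b1

end Radial

/-! ### Spherical waves -/

/-- The outgoing spherical wave `exp(ikr) / (4πr)`. -/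
noncomputable def sphericalWave (k : ℂ) (r : ℝ) : ℂ :=
  Complex.exp (Complex.I * k * r) / (4 * Real.pi * r)

/-- The flux `4πr² ∂ᵣ` of the spherical wave. -/
noncomputable def waveFlux (k : ℂ) (r : ℝ) : ℂ :=
  (Complex.I * k * r - 1) * Complex.exp (Complex.I * k * r)

theorem hasDerivAt_exp_I_mul (k : ℂ) (r : ℝ) :
    HasDerivAt (fun r : ℝ => Complex.exp (Complex.I * k * r))
      (Complex.I * k * Complex.exp (Complex.I * k * r)) r := by
  have h : HasDerivAt (fun r : ℝ => Complex.I * k * (r : ℂ)) (Complex.I * k * 1) r :=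
    (Complex.ofRealCLM.hasDerivAt (x := r)).const_mul (Complex.I * k)
  exact h.cexp.congr_deriv (by ring)

theorem hasDerivAt_waveFlux (k : ℂ) (r : ℝ) :
    HasDerivAt (waveFlux k) (-k ^ 2 * r * Complex.exp (Complex.I * k * r)) r := by
  have h : HasDerivAt (fun r : ℝ => Complex.I * k * (r : ℂ) - 1) (Complex.I * k * 1) r :=
    ((Complex.ofRealCLM.hasDerivAt (x := r)).const_mul (Complex.I * k)).sub_const 1
  refine (h.mul (hasDerivAt_exp_I_mul k r)).congr_deriv ?_
  linear_combination k ^ 2 * r * Complex.exp (Complex.I * k * r) * Complex.I_sq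

theorem four_pi_ne_zero : (4 * Real.pi : ℂ) ≠ 0 := by
  simp [Real.pi_ne_zero]

theorem hasDerivAt_sphericalWave (k : ℂ) {r : ℝ} (hr : 0 < r) :
    HasDerivAt (sphericalWave k) (waveFlux k r / (4 * Real.pi * r ^ 2)) r := by
  have hrC : (r : ℂ) ≠ 0 := by exact_mod_cast hr.ne'
  have hpi := four_pi_ne_zero
  have h : HasDerivAt (fun r : ℝ => 4 * Real.pi * (r : ℂ)) (4 * Real.pi * 1) r :=
    (Complex.ofRealCLM.hasDerivAt (x := r)).const_mul _
  refine ((hasDerivAt_exp_I_mul k r).div h (mul_ne_zero hpi hrC)).congr_deriv ?_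
  rw [waveFlux]
  field_simp

theorem hasDerivAt_deriv_sphericalWave (k : ℂ) {r : ℝ} (hr : 0 < r) :
    HasDerivAt (fun r : ℝ => waveFlux k r / (4 * Real.pi * r ^ 2))
      (-k ^ 2 * sphericalWave k r - 2 * (waveFlux k r / (4 * Real.pi * r ^ 2)) / r) r := by
  have hrC : (r : ℂ) ≠ 0 := by exact_mod_cast hr.ne'
  have hpi := four_pi_ne_zero
  have h : HasDerivAt (fun r : ℝ => 4 * Real.pi * (r : ℂ) ^ 2) _ r :=
    ((Complex.ofRealCLM.hasDerivAt (x := r)).pow 2).const_mul _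
  refine ((hasDerivAt_waveFlux k r).div h (mul_ne_zero hpi (pow_ne_zero 2 hrC))).congr_deriv ?_
  rw [sphericalWave]
  simp
  field_simp

theorem contDiffOn_sphericalWave (k : ℂ) : ContDiffOn ℝ ∞ (sphericalWave k) (Set.Ioi 0) := by
  have hc : ContDiff ℝ ∞ (fun r : ℝ => (r : ℂ)) := Complex.ofRealCLM.contDiff
  have he : sphericalWave k =
      fun r : ℝ => Complex.exp (Complex.I * k * r) * (4 * Real.pi * (r : ℂ))⁻¹ :=
    funext fun r => div_eq_mul_inv _ _
  rw [he]
  refine ContDiffOn.mul ?_ ((contDiff_const.mul hc).contDiffOn.inv fun r hr => ?_)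
  · exact ((contDiff_const.mul hc).cexp).contDiffOn
  · have : r ≠ 0 := ne_of_gt hr
    exact mul_ne_zero four_pi_ne_zero (by exact_mod_cast this)

theorem continuous_waveFlux (k : ℂ) : Continuous (waveFlux k) :=
  continuous_iff_continuousAt.2 fun r => (hasDerivAt_waveFlux k r).continuousAt

theorem exists_bound_of_continuous_Icc {c : ℝ → ℂ} (hc : Continuous c) (R : ℝ) :
    ∃ C : ℝ, ∀ r, 0 ≤ r → r ≤ R → ‖c r‖ ≤ C := by
  obtain ⟨C, hC⟩ := (isCompact_Icc (a := (0 : ℝ)) (b := R)).exists_bound_of_continuousOn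
    hc.continuousOn
  exact ⟨C, fun r h0 hR => hC r ⟨h0, hR⟩⟩

theorem exists_bound_sphericalWave (k : ℂ) (R : ℝ) :
    ∃ C : ℝ, ∀ r, 0 < r → r ≤ R → r ^ 2 * ‖sphericalWave k r‖ ≤ C := by
  obtain ⟨C, hC⟩ := exists_bound_of_continuous_Icc
    (c := fun r : ℝ => r * Complex.exp (Complex.I * k * r) / (4 * Real.pi)) (by fun_prop) R
  refine ⟨C, fun r h0 hR => le_trans (le_of_eq ?_) (hC r h0.le hR)⟩
  have hrC : (r : ℂ) ≠ 0 := by exact_mod_cast h0.ne'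
  have hpi := four_pi_ne_zero
  have : (r : ℂ) * Complex.exp (Complex.I * k * r) / (4 * Real.pi) =
      (r : ℂ) ^ 2 * sphericalWave k r := by
    rw [sphericalWave]
    field_simp
  rw [this]
  simp

theorem exists_bound_deriv_sphericalWave (k : ℂ) (R : ℝ) :
    ∃ C : ℝ, ∀ r, 0 < r → r ≤ R → r ^ 2 * ‖waveFlux k r / (4 * Real.pi * r ^ 2)‖ ≤ C := by
  obtain ⟨C, hC⟩ := exists_bound_of_continuous_Icc
    (c := fun r : ℝ => waveFlux k r / (4 * Real.pi)) ((continuous_waveFlux k).div_const _) R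
  refine ⟨C, fun r h0 hR => le_trans (le_of_eq ?_) (hC r h0.le hR)⟩
  have hrC : (r : ℂ) ≠ 0 := by exact_mod_cast h0.ne'
  have hpi := four_pi_ne_zero
  have : waveFlux k r / (4 * Real.pi) =
      (r : ℂ) ^ 2 * (waveFlux k r / (4 * Real.pi * r ^ 2)) := by
    field_simp
  rw [this, norm_mul]
  simp

/-- The flux starts at `-1` for every `k` and its derivative is `O(r)`. The difference of two fluxes
is therefore `O(r²)`, which makes the gradient of a difference of two waves bounded. -/
theorem exists_bound_waveFlux_add_one (k : ℂ) (R : ℝ) :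
    ∃ C : ℝ, ∀ r, 0 < r → r ≤ R → ‖waveFlux k r + 1‖ ≤ C * r ^ 2 := by
  obtain ⟨C, hC⟩ := exists_bound_of_continuous_Icc
    (c := fun r : ℝ => -k ^ 2 * Complex.exp (Complex.I * k * r)) (by fun_prop) R
  refine ⟨C, fun r h0 hR => ?_⟩
  -- On `[0, r]` the derivative is at most `C r`, so the increment is at most `C r · r`.
  have h := norm_image_sub_le_of_norm_deriv_le_segment' (f := waveFlux k) (a := 0) (b := r)
    (C := C * r) (fun s _ => (hasDerivAt_waveFlux k s).hasDerivWithinAt) (fun s hs => by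
      have h1 := hC s hs.1 (hs.2.le.trans hR)
      have : -k ^ 2 * s * Complex.exp (Complex.I * k * s) =
          -k ^ 2 * Complex.exp (Complex.I * k * s) * s := by ring
      rw [this, norm_mul, Complex.norm_real, Real.norm_of_nonneg hs.1]
      exact mul_le_mul h1 hs.2.le hs.1 ((norm_nonneg _).trans h1)) r ⟨h0.le, le_rfl⟩
  have h0' : waveFlux k 0 = -1 := by simp [waveFlux]
  rw [h0', sub_neg_eq_add, sub_zero] at h
  linarith

theorem contDiffOn_sphericalWave_norm (k : ℂ) :
    ContDiffOn ℝ ∞ (fun x : E3 => sphericalWave k ‖x‖) {0}ᶜ :=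
  contDiffOn_comp_norm (contDiffOn_sphericalWave k)

theorem locallyIntegrable_sphericalWave (k : ℂ) :
    LocallyIntegrable (fun x : E3 => sphericalWave k ‖x‖) volume :=
  locallyIntegrable_of_radial (contDiffOn_sphericalWave_norm k) (fun _ _ => rfl)
    (exists_bound_sphericalWave k)

/-- One integration by parts leaves `∇w · ∇φ`, which is the radial derivative of `φ` weighted by the
flux over `4πr²`. The divergence identity then applies with `a = waveFlux k`, and `waveFlux k 0 =
-1` produces `φ 0`. -/
theorem integral_sphericalWave_mul (k : ℂ) {φ : E3 → ℂ} (hφ : ContDiff ℝ ∞ φ)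
    (hc : HasCompactSupport φ) :
    ∑ i, ∫ x : E3, sphericalWave k ‖x‖ * pderiv3 i (pderiv3 i φ) x =
      -φ 0 - k ^ 2 * ∫ x : E3, sphericalWave k ‖x‖ * φ x := by
  set f : E3 → ℂ := fun x => sphericalWave k ‖x‖ with hf
  have hfs := contDiffOn_sphericalWave_norm k
  have hl := locallyIntegrable_sphericalWave k
  have hd : ∀ r : ℝ, 0 < r → HasDerivAt (sphericalWave k)
    ((fun r : ℝ => waveFlux k r / (4 * Real.pi * r ^ 2)) r) r :=
    fun r hr => hasDerivAt_sphericalWave k hr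
  have hl' := locallyIntegrable_pderiv3_of_radial hfs (fun _ _ => rfl) hd
    (exists_bound_deriv_sphericalWave k)
  have hW : ∀ i, ∫ x : E3, f x * pderiv3 i (pderiv3 i φ) x =
      -∫ x : E3, pderiv3 i f x * pderiv3 i φ x := fun i =>
    integral_mul_pderiv3_eq_neg i (fun x hx => hfs.differentiableAt_compl_zero hx) hl (hl' i)
      ((hφ.pderiv3 i).of_le (by exact_mod_cast le_top)) (hc.pderiv3 i)
  have hi : ∀ i, Integrable (fun x => pderiv3 i f x * pderiv3 i φ x) volume := fun i =>
    (hl' i).integrable_mul_of_hasCompactSupport (hφ.pderiv3 i).continuous (hc.pderiv3 i)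
  have hi0 : Integrable (fun x => f x * φ x) volume :=
    hl.integrable_mul_of_hasCompactSupport hφ.continuous hc
  have hpol := integral_radial_divergence (hasDerivAt_waveFlux k) (by fun_prop)
    (hφ.of_le (by exact_mod_cast le_top)) hc
  have he : ∫ x : E3, (waveFlux k ‖x‖ * fderiv ℝ φ x (‖x‖⁻¹ • x) +
      -k ^ 2 * ‖x‖ * Complex.exp (Complex.I * k * ‖x‖) * φ x) / (‖x‖ : ℂ) ^ 2 =
      ∫ x : E3, (4 * Real.pi * (∑ i, pderiv3 i f x * pderiv3 i φ x) +
        -(4 * Real.pi * k ^ 2) * (f x * φ x)) := by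
    refine integral_congr_ae ?_
    have h0 : ∀ᵐ x ∂(volume : Measure E3), x ≠ 0 := by simp [ae_iff]
    filter_upwards [h0] with x hx
    have hn : 0 < ‖x‖ := norm_pos_iff.2 hx
    have hnC : (‖x‖ : ℂ) ≠ 0 := by exact_mod_cast hn.ne'
    have hpi := four_pi_ne_zero
    have hpi' : (Real.pi : ℂ) ≠ 0 := by simp [Real.pi_ne_zero]
    simp only [pderiv3_of_radial (f := f) (fun _ _ => rfl) hd hx]
    simp only [fderiv_apply_eq_sum_pderiv3, Fin.sum_univ_three, hf, sphericalWave, PiLp.smul_apply, smul_eq_mul, Complex.ofReal_mul,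
      Complex.ofReal_inv]
    field_simp
  rw [he, integral_add (((integrable_finsetSum _ fun i _ => hi i)).const_mul _)
    (hi0.const_mul _), integral_const_mul, integral_const_mul,
    integral_finsetSum _ fun i _ => hi i] at hpol
  change ∑ i, ∫ x : E3, f x * pderiv3 i (pderiv3 i φ) x = -φ 0 - k ^ 2 * ∫ x : E3, f x * φ x
  simp only [hW, Finset.sum_neg_distrib]
  have h0' : waveFlux k 0 = -1 := by simp [waveFlux]
  rw [h0'] at hpol
  apply mul_left_cancel₀ four_pi_ne_zero
  linear_combination -hpol

/-! ### The radial potential of a difference of two spherical waves -/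

/-- The last clause is what cancels the extra terms in the elastic equation. It is trivial for `κ =
0`, where both wavenumbers vanish, and otherwise it defines `u`. -/
theorem exists_radial_potential {k₀ k₁ α₀ α₁ κ : ℂ} (h₀ : κ * α₀ = k₀ ^ 2)
    (h₁ : κ * α₁ = k₁ ^ 2) :
    ∃ u u' u'' : ℝ → ℂ, ContDiffOn ℝ ∞ u (Set.Ioi 0) ∧
      (∀ r, 0 < r → HasDerivAt u (u' r) r) ∧ (∀ r, 0 < r → HasDerivAt u' (u'' r) r) ∧
      (∀ r, 0 < r → u'' r + 2 * u' r / r =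
        α₀ * sphericalWave k₀ r - α₁ * sphericalWave k₁ r) ∧
      (∀ R : ℝ, ∃ C : ℝ, ∀ r, 0 < r → r ≤ R → r ^ 2 * ‖u r‖ ≤ C) ∧
      (∀ R : ℝ, ∃ C : ℝ, ∀ r, 0 < r → r ≤ R → ‖u' r‖ ≤ C) ∧
      (∀ r, 0 < r → sphericalWave k₀ r - sphericalWave k₁ r + κ * u r = 0) := by
  have hpi := four_pi_ne_zero
  have hpi' : (Real.pi : ℂ) ≠ 0 := by simp [Real.pi_ne_zero]
  by_cases hκ : κ = 0
  · have hk₀ : k₀ = 0 := by simpa [hκ] using h₀.symm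
    have hk₁ : k₁ = 0 := by simpa [hκ] using h₁.symm
    subst hκ hk₀ hk₁
    -- The source is now `(α₀ - α₁)/(4πr)`, and a linear function of slope `a` has Laplacian `2a/r`;
    -- hence the constant `8π`.
    have hd : ∀ r : ℝ, HasDerivAt (fun r : ℝ => (α₀ - α₁) / (8 * Real.pi) * (r : ℂ))
        ((α₀ - α₁) / (8 * Real.pi)) r := fun r => by
      refine ((Complex.ofRealCLM.hasDerivAt (x := r)).const_mul _).congr_deriv ?_
      simp
    refine ⟨fun r => (α₀ - α₁) / (8 * Real.pi) * r, fun _ => (α₀ - α₁) / (8 * Real.pi),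
      fun _ => 0, ?_, fun r _ => hd r, fun r _ => hasDerivAt_const _ _, fun r hr => ?_,
      fun R => ?_, fun R => ⟨_, fun r _ _ => le_rfl⟩, fun r _ => by simp⟩
    · exact (contDiff_const.mul Complex.ofRealCLM.contDiff).contDiffOn
    · have hrC : (r : ℂ) ≠ 0 := by exact_mod_cast hr.ne'
      simp only [sphericalWave, mul_zero, zero_mul, Complex.exp_zero]
      field_simp
      ring
    · obtain ⟨C, hC⟩ := exists_bound_of_continuous_Icc
        (c := fun r : ℝ => (r : ℂ) ^ 2 * ((α₀ - α₁) / (8 * Real.pi) * r)) (by fun_prop) R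
      refine ⟨C, fun r h0 hR => le_trans (le_of_eq ?_) (hC r h0.le hR)⟩
      rw [norm_mul _ (_ * _)]
      simp
  · have hα₀ : α₀ = k₀ ^ 2 / κ := by rw [eq_div_iff hκ, ← h₀, mul_comm]
    have hα₁ : α₁ = k₁ ^ 2 / κ := by rw [eq_div_iff hκ, ← h₁, mul_comm]
    refine ⟨fun r => (sphericalWave k₁ r - sphericalWave k₀ r) / κ,
      fun r => (waveFlux k₁ r / (4 * Real.pi * r ^ 2) - waveFlux k₀ r / (4 * Real.pi * r ^ 2)) / κ,
      _, ?_, fun r hr => ((hasDerivAt_sphericalWave k₁ hr).sub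
        (hasDerivAt_sphericalWave k₀ hr)).div_const κ,
      fun r hr => ((hasDerivAt_deriv_sphericalWave k₁ hr).sub
        (hasDerivAt_deriv_sphericalWave k₀ hr)).div_const κ, fun r hr => ?_, fun R => ?_,
      fun R => ?_, fun r hr => ?_⟩
    · exact ((contDiffOn_sphericalWave k₁).sub (contDiffOn_sphericalWave k₀)).div_const κ
    · rw [hα₀, hα₁]
      ring
    · obtain ⟨C, hC⟩ := exists_bound_sphericalWave k₀ R
      obtain ⟨C', hC'⟩ := exists_bound_sphericalWave k₁ R
      refine ⟨(C' + C) / ‖κ‖, fun r h0 hR => ?_⟩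
      rw [norm_div, ← mul_div_assoc]
      gcongr
      calc r ^ 2 * ‖sphericalWave k₁ r - sphericalWave k₀ r‖
          ≤ r ^ 2 * (‖sphericalWave k₁ r‖ + ‖sphericalWave k₀ r‖) := by
            gcongr
            exact norm_sub_le _ _
        _ ≤ C' + C := by
            rw [mul_add]
            exact add_le_add (hC' r h0 hR) (hC r h0 hR)
    · obtain ⟨C, hC⟩ := exists_bound_waveFlux_add_one k₀ R
      obtain ⟨C', hC'⟩ := exists_bound_waveFlux_add_one k₁ R
      refine ⟨(C' + C) / ‖(4 * Real.pi * κ : ℂ)‖, fun r h0 hR => ?_⟩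
      have hrC : (r : ℂ) ≠ 0 := by exact_mod_cast h0.ne'
      have he : (waveFlux k₁ r / (4 * Real.pi * r ^ 2) -
          waveFlux k₀ r / (4 * Real.pi * r ^ 2)) / κ =
          ((waveFlux k₁ r + 1) - (waveFlux k₀ r + 1)) / (r : ℂ) ^ 2 / (4 * Real.pi * κ) := by
        field_simp
        ring
      simp only [he]
      rw [norm_div]
      gcongr
      rw [norm_div, norm_pow, Complex.norm_real, Real.norm_of_nonneg h0.le,
        div_le_iff₀ (by positivity), add_mul]
      exact (norm_sub_le _ _).trans (add_le_add (hC' r h0 hR) (hC r h0 hR))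
    · field_simp
      ring

theorem isPotential_of_radial {f : E3 → ℂ} {u u' u'' g : ℝ → ℂ}
    (hf : ∀ x, x ≠ 0 → f x = g ‖x‖) (hus : ContDiffOn ℝ ∞ u (Set.Ioi 0))
    (hu : ∀ r, 0 < r → HasDerivAt u (u' r) r) (hu' : ∀ r, 0 < r → HasDerivAt u' (u'' r) r)
    (hode : ∀ r, 0 < r → u'' r + 2 * u' r / r = g r)
    (hb : ∀ R : ℝ, ∃ C : ℝ, ∀ r, 0 < r → r ≤ R → ‖u' r‖ ≤ C) :
    IsPotential (normSqM vecD1) f (fun x => u ‖x‖) := by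
  refine ⟨contDiffOn_comp_norm hus, fun x hx => ?_, ?_, fun U _ _ x => by simp only [U.norm_map]⟩
  · rw [quadOp_normSqM_vecD1, sum_pderiv3_pderiv3_of_radial (fun _ _ => rfl) hu hu' hx,
      hode _ (norm_pos_iff.2 hx), hf x hx]
  · obtain ⟨C, hC⟩ := hb 1
    refine ⟨C, ?_⟩
    filter_upwards [self_mem_nhdsWithin, nhdsWithin_le_nhds (Metric.ball_mem_nhds (0 : E3) one_pos)]
      with x hx hx1
    have hn : 0 < ‖x‖ := norm_pos_iff.2 hx
    rw [(hasFDerivAt_of_radial (u := u) (fun _ _ => rfl) hx (hu _ hn)).fderiv,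
      ContinuousLinearMap.norm_smulRight_apply, norm_smul, innerSL_apply_norm, norm_inv, norm_norm,
      inv_mul_cancel₀ hn.ne', one_mul]
    exact hC _ hn (mem_ball_zero_iff.1 hx1).le

/-! ### Distributional equations -/

theorem ae_ne_zero_E3 : ∀ᵐ x ∂(volume : Measure E3), x ≠ 0 := by
  simp [ae_iff]

theorem isScalarFundamental_sphericalWave {q : Matrix (Fin 3) (Fin 3) ℂ} {m k α : ℂ}
    (hq : ∀ (φ : E3 → ℂ) (x : E3), quadOp q φ x = m * ∑ i, pderiv3 i (pderiv3 i φ) x) :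
    IsScalarFundamental q (m * k ^ 2) (-(m * α)) (fun x => α * sphericalWave k ‖x‖) := by
  have hl := locallyIntegrable_sphericalWave k
  refine ⟨hl.smul α, fun φ hφ hc => ?_⟩
  have hi : ∀ i, Integrable
      (fun x : E3 => sphericalWave k ‖x‖ * pderiv3 i (pderiv3 i φ) x) volume := fun i =>
    hl.integrable_mul_of_hasCompactSupport ((hφ.pderiv3 i).pderiv3 i).continuous
      ((hc.pderiv3 i).pderiv3 i)
  have hi0 : Integrable (fun x : E3 => sphericalWave k ‖x‖ * φ x) volume :=
    hl.integrable_mul_of_hasCompactSupport hφ.continuous hc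
  have he : ∀ x : E3, α * sphericalWave k ‖x‖ * (quadOp q φ x + m * k ^ 2 * φ x) =
      α * m * (∑ i, sphericalWave k ‖x‖ * pderiv3 i (pderiv3 i φ) x) +
        α * m * k ^ 2 * (sphericalWave k ‖x‖ * φ x) := by
    intro x
    rw [hq, ← Finset.mul_sum]
    ring
  simp_rw [he]
  rw [integral_add ((integrable_finsetSum _ fun i _ => hi i).const_mul _) (hi0.const_mul _),
    integral_const_mul, integral_const_mul, integral_finsetSum _ fun i _ => hi i,
    integral_sphericalWave_mul k hφ hc]
  ring

theorem integral_pderiv3_pderiv3_mul {Ψ φ : E3 → ℂ} (hΨ : ContDiffOn ℝ ∞ Ψ {0}ᶜ)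
    (h0 : LocallyIntegrable Ψ volume) (h1 : ∀ i, LocallyIntegrable (pderiv3 i Ψ) volume)
    (h2 : ∀ i j, LocallyIntegrable (pderiv3 i (pderiv3 j Ψ)) volume)
    (hφ : ContDiff ℝ ∞ φ) (hc : HasCompactSupport φ) (i j : Fin 3) :
    ∫ x, pderiv3 i (pderiv3 j Ψ) x * φ x = ∫ x, Ψ x * pderiv3 j (pderiv3 i φ) x := by
  have e1 := integral_mul_pderiv3_eq_neg (u := pderiv3 j Ψ) i
    (fun x hx => (hΨ.pderiv3 j).differentiableAt_compl_zero hx) (h1 j) (h2 i j)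
    (hφ.of_le (by exact_mod_cast le_top)) hc
  have e2 := integral_mul_pderiv3_eq_neg (u := Ψ) j
    (fun x hx => hΨ.differentiableAt_compl_zero hx) h0 (h1 j)
    ((hφ.pderiv3 i).of_le (by exact_mod_cast le_top)) (hc.pderiv3 i)
  rw [e2, e1, neg_neg]

/-! ### The isotropic Medium III tensor -/

/-- The Lamé form with `λ = m11 - 2 m44` and shear modulus `m44`. -/
theorem mediumIIITensor_eq {R : Type} [CommRing R] {μ : Moduli R} (h : μ.m66 = μ.m44)
    (i j k l : Fin 3) :
    mediumIIITensor μ i j k l =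
      (μ.m11 - 2 * μ.m44) * ((1 : Matrix (Fin 3) (Fin 3) R) i j *
        (1 : Matrix (Fin 3) (Fin 3) R) k l) +
      μ.m44 * ((1 : Matrix (Fin 3) (Fin 3) R) i k * (1 : Matrix (Fin 3) (Fin 3) R) j l +
        (1 : Matrix (Fin 3) (Fin 3) R) i l * (1 : Matrix (Fin 3) (Fin 3) R) j k) := by
  fin_cases i <;> fin_cases j <;> fin_cases k <;> fin_cases l <;>
    simp [mediumIIITensor, mediumIIIVoigt, voigtIndex, h] <;> ring

theorem isIsotropicTensor_mediumIIITensor {μ : Moduli ℝ} (h : μ.m66 = μ.m44) :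
    IsIsotropicTensor (mediumIIITensor μ) := by
  intro Q hQ i j k l
  have hO : ∀ i j : Fin 3, (1 : Matrix (Fin 3) (Fin 3) ℝ) i j =
      Q i 0 * Q j 0 + Q i 1 * Q j 1 + Q i 2 * Q j 2 := by
    intro i j
    rw [← (Matrix.mem_orthogonalGroup_iff (Fin 3) ℝ).1 hQ, Matrix.mul_apply, Fin.sum_univ_three]
    rfl
  rw [mediumIIITensor_eq h i j k l]
  simp only [mediumIIITensor_eq h, mul_add, Finset.sum_add_distrib]
  simp only [Matrix.one_apply, Fin.sum_univ_three]
  -- Each delta in the free indices becomes an entry of `Q Qᵀ`, while those in the summed indices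
  -- evaluate; both sides are then polynomials in the entries of `Q`.
  simp only [← Matrix.one_apply, hO i j, hO k l, hO i k, hO j l, hO i l, hO j k]
  simp
  ring

theorem quadOp_christoffel_eq {μ : Moduli ℂ} (h : μ.m66 = μ.m44) {φ : E3 → ℂ}
    (hφ : ContDiff ℝ ∞ φ) (i j : Fin 3) (x : E3) :
    quadOp (christoffel μ i j) φ x = (μ.m11 - μ.m44) * pderiv3 i (pderiv3 j φ) x +
      (1 : Matrix (Fin 3) (Fin 3) ℂ) i j * (μ.m44 * ∑ k, pderiv3 k (pderiv3 k φ) x) := by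
  simp only [quadOp, christoffel, Matrix.of_apply, mediumIIITensor_eq h, Fin.sum_univ_three]
  simp only [Matrix.one_apply]
  rw [pderiv3_comm hφ 1 0, pderiv3_comm hφ 2 0, pderiv3_comm hφ 2 1]
  fin_cases i <;> fin_cases j <;> simp [pderiv3_comm hφ 1 0, pderiv3_comm hφ 2 0,
    pderiv3_comm hφ 2 1] <;> ring

/-- The shape is that of the expanded integrand in the elastic equation. -/
theorem integral_combination {f₁ f₂ f₃ g₁ g₂ g₃ : E3 → ℂ} (hf₁ : Integrable f₁ volume)
    (hf₂ : Integrable f₂ volume) (hf₃ : Integrable f₃ volume) (hg₁ : Integrable g₁ volume)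
    (hg₂ : Integrable g₂ volume) (hg₃ : Integrable g₃ volume) (a b c d e : ℂ) :
    ∫ x, (a * f₁ x + b * (c * f₂ x + d * f₃ x) + (e * g₁ x + (c * g₂ x + d * g₃ x))) =
      a * (∫ x, f₁ x) + b * (c * (∫ x, f₂ x) + d * ∫ x, f₃ x) +
        (e * (∫ x, g₁ x) + (c * (∫ x, g₂ x) + d * ∫ x, g₃ x)) := by
  have h₁ : Integrable (fun x => c * f₂ x + d * f₃ x) volume :=
    (hf₂.const_mul c).add (hf₃.const_mul d)
  have h₂ : Integrable (fun x => c * g₂ x + d * g₃ x) volume :=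
    (hg₂.const_mul c).add (hg₃.const_mul d)
  have h₃ : Integrable (fun x => a * f₁ x + b * (c * f₂ x + d * f₃ x)) volume :=
    (hf₁.const_mul a).add (h₁.const_mul b)
  have h₄ : Integrable (fun x => e * g₁ x + (c * g₂ x + d * g₃ x)) volume :=
    (hg₁.const_mul e).add h₂
  rw [integral_add h₃ h₄, integral_add (hf₁.const_mul a) (h₁.const_mul b), integral_const_mul,
    integral_const_mul, integral_add (hf₂.const_mul c) (hf₃.const_mul d), integral_const_mul,
    integral_const_mul, integral_add (hg₁.const_mul e) h₂, integral_const_mul,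
    integral_add (hg₂.const_mul c) (hg₃.const_mul d), integral_const_mul, integral_const_mul]

/-- Writing the operator as `(m11 - m44) ∂ᵢ∂ⱼ + δᵢⱼ m44 Δ`, the term `α₁ w_{k₁} I` yields `-δ I`
together with `(m11 - m44) α₁ ∂ᵢ∂ⱼ w_{k₁}`. With `ΔΨ = α₀ w_{k₀} - α₁ w_{k₁}` and `m11 α₀ = m44 α₁ =
1`, everything else adds up to `∂ᵢ∂ⱼ(w_{k₀} - w_{k₁} + κΨ)`, which is zero by `hN`. -/
theorem isElasticFundamental_of_radial {k₀ k₁ α₀ α₁ κ : ℂ} {μ : Moduli ℂ}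
    (hμ : μ.m66 = μ.m44) (hμ₀ : μ.m11 * α₀ = 1) (hμ₁ : μ.m44 * α₁ = 1)
    (h₁ : κ * α₁ = k₁ ^ 2) {u u' u'' : ℝ → ℂ} (hus : ContDiffOn ℝ ∞ u (Set.Ioi 0))
    (hu : ∀ r, 0 < r → HasDerivAt u (u' r) r) (hu' : ∀ r, 0 < r → HasDerivAt u' (u'' r) r)
    (hode : ∀ r, 0 < r → u'' r + 2 * u' r / r =
      α₀ * sphericalWave k₀ r - α₁ * sphericalWave k₁ r)
    (hb : ∀ R : ℝ, ∃ C : ℝ, ∀ r, 0 < r → r ≤ R → r ^ 2 * ‖u r‖ ≤ C)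
    (hb' : ∀ R : ℝ, ∃ C : ℝ, ∀ r, 0 < r → r ≤ R → ‖u' r‖ ≤ C)
    (hN : ∀ r, 0 < r → sphericalWave k₀ r - sphericalWave k₁ r + κ * u r = 0)
    {G : E3 → Matrix (Fin 3) (Fin 3) ℂ}
    (hG : ∀ x, x ≠ 0 → ∀ i j, G x i j =
      α₁ * sphericalWave k₁ ‖x‖ * (1 : Matrix (Fin 3) (Fin 3) ℂ) i j +
        pderiv3 i (pderiv3 j fun y => u ‖y‖) x) :
    IsElasticFundamental μ κ (-1) G := by
  set Ψ : E3 → ℂ := fun y => u ‖y‖ with hΨdef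
  have hΨ : ContDiffOn ℝ ∞ Ψ {0}ᶜ := contDiffOn_comp_norm hus
  have hrad : ∀ x : E3, x ≠ 0 → Ψ x = u ‖x‖ := fun _ _ => rfl
  have hb1 : ∀ R : ℝ, ∃ C : ℝ, ∀ r, 0 < r → r ≤ R → r * ‖u' r‖ ≤ C := by
    intro R
    obtain ⟨C, hC⟩ := hb' R
    exact ⟨R * C, fun r h0 hR => mul_le_mul hR (hC r h0 hR) (norm_nonneg _) (h0.le.trans hR)⟩
  have hb2 : ∀ R : ℝ, ∃ C : ℝ, ∀ r, 0 < r → r ≤ R → r ^ 2 * ‖u' r‖ ≤ C := by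
    intro R
    obtain ⟨C, hC⟩ := hb1 R
    refine ⟨R * C, fun r h0 hR => ?_⟩
    rw [pow_two, mul_assoc]
    exact mul_le_mul hR (hC r h0 hR) (by positivity) (h0.le.trans hR)
  -- The bound on `u''` is read off the radial equation.
  have hb3 : ∀ R : ℝ, ∃ C : ℝ, ∀ r, 0 < r → r ≤ R → r ^ 2 * ‖u'' r‖ ≤ C := by
    intro R
    obtain ⟨C, hC⟩ := hb1 R
    obtain ⟨C₀, hC₀⟩ := exists_bound_sphericalWave k₀ R
    obtain ⟨C₁, hC₁⟩ := exists_bound_sphericalWave k₁ R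
    refine ⟨‖α₀‖ * C₀ + ‖α₁‖ * C₁ + 2 * C, fun r h0 hR => ?_⟩
    have hrC : (r : ℂ) ≠ 0 := by exact_mod_cast h0.ne'
    have he : (r : ℂ) ^ 2 * u'' r = α₀ * (r ^ 2 * sphericalWave k₀ r) -
        α₁ * (r ^ 2 * sphericalWave k₁ r) - 2 * (r * u' r) := by
      rw [eq_sub_of_add_eq (hode r h0)]
      field_simp
    have hl : r ^ 2 * ‖u'' r‖ = ‖(r : ℂ) ^ 2 * u'' r‖ := by simp
    rw [hl, he]
    refine (norm_sub_le _ _).trans (add_le_add ((norm_sub_le _ _).trans (add_le_add ?_ ?_)) ?_)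
    · rw [norm_mul]
      exact mul_le_mul_of_nonneg_left (by simpa using hC₀ r h0 hR) (norm_nonneg _)
    · rw [norm_mul]
      exact mul_le_mul_of_nonneg_left (by simpa using hC₁ r h0 hR) (norm_nonneg _)
    · rw [norm_mul, norm_mul, Complex.norm_real, Real.norm_of_nonneg h0.le]
      simpa using hC r h0 hR
  have l0 : LocallyIntegrable Ψ volume := locallyIntegrable_of_radial hΨ hrad hb
  have l1 := locallyIntegrable_pderiv3_of_radial hΨ hrad hu hb2
  have l2 := locallyIntegrable_pderiv3_pderiv3_of_radial hΨ hrad hu hu' hb1 hb3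
  have lw : ∀ k, LocallyIntegrable (fun x : E3 => sphericalWave k ‖x‖) volume :=
    locallyIntegrable_sphericalWave
  refine ⟨fun i j => ?_, fun φ hφ hc i j => ?_⟩
  · have : LocallyIntegrable (fun x => ((1 : Matrix (Fin 3) (Fin 3) ℂ) i j * α₁) •
        sphericalWave k₁ ‖x‖ + pderiv3 i (pderiv3 j Ψ) x) volume :=
      ((lw k₁).smul ((1 : Matrix (Fin 3) (Fin 3) ℂ) i j * α₁)).add (l2 i j)
    refine this.congr ?_
    filter_upwards [ae_ne_zero_E3] with x hx
    rw [hG x hx, smul_eq_mul]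
    ring
  · set χ : E3 → ℂ := pderiv3 i (pderiv3 j φ) with hχ
    have hχs : ContDiff ℝ ∞ χ := (hφ.pderiv3 j).pderiv3 i
    have hχc : HasCompactSupport χ := (hc.pderiv3 j).pderiv3 i
    have hbp : ∀ {ψ : E3 → ℂ}, ContDiff ℝ ∞ ψ → HasCompactSupport ψ → ∀ a b : Fin 3,
        ∫ x, pderiv3 a (pderiv3 b Ψ) x * ψ x = ∫ x, Ψ x * pderiv3 b (pderiv3 a ψ) x :=
      fun hψ hψc a b => integral_pderiv3_pderiv3_mul hΨ l0 l1 l2 hψ hψc a b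
    have hs2 : ∀ a b : Fin 3, ContDiff ℝ ∞ (pderiv3 a (pderiv3 b φ)) := fun a b =>
      (hφ.pderiv3 b).pderiv3 a
    have hc2 : ∀ a b : Fin 3, HasCompactSupport (pderiv3 a (pderiv3 b φ)) := fun a b =>
      (hc.pderiv3 b).pderiv3 a
    have hI : ∀ {g ψ : E3 → ℂ}, LocallyIntegrable g volume → ContDiff ℝ ∞ ψ →
        HasCompactSupport ψ → Integrable (fun x => g x * ψ x) volume :=
      fun hg hψ hψc => hg.integrable_mul_of_hasCompactSupport hψ.continuous hψc
    -- the pointwise expansion of the integrand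
    have hexp : ∫ x, ∑ k, G x k j * (quadOp (christoffel μ i k) φ x +
        κ * (1 : Matrix (Fin 3) (Fin 3) ℂ) i k * φ x) =
        ∫ x, (α₁ * (μ.m11 - μ.m44) * (sphericalWave k₁ ‖x‖ * χ x) +
          (1 : Matrix (Fin 3) (Fin 3) ℂ) i j * α₁ *
            (μ.m44 * (∑ k, sphericalWave k₁ ‖x‖ * pderiv3 k (pderiv3 k φ) x) +
              κ * (sphericalWave k₁ ‖x‖ * φ x)) +
          ((μ.m11 - μ.m44) * (∑ k, pderiv3 k (pderiv3 j Ψ) x * pderiv3 i (pderiv3 k φ) x) +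
            (μ.m44 * (∑ k, pderiv3 i (pderiv3 j Ψ) x * pderiv3 k (pderiv3 k φ) x) +
              κ * (pderiv3 i (pderiv3 j Ψ) x * φ x)))) := by
      refine integral_congr_ae ?_
      filter_upwards [ae_ne_zero_E3] with x hx
      simp only [quadOp_christoffel_eq hμ hφ, hG x hx, Fin.sum_univ_three, hχ,
        Matrix.one_apply]
      fin_cases i <;> fin_cases j <;> simp <;> ring
    have iχ : Integrable (fun x : E3 => sphericalWave k₁ ‖x‖ * χ x) volume := hI (lw k₁) hχs hχc
    have iw : ∀ k, Integrable (fun x : E3 => sphericalWave k₁ ‖x‖ * pderiv3 k (pderiv3 k φ) x)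
      volume := fun k => hI (lw k₁) (hs2 k k) (hc2 k k)
    have iφ : Integrable (fun x : E3 => sphericalWave k₁ ‖x‖ * φ x) volume := hI (lw k₁) hφ hc
    have iA : ∀ k, Integrable
      (fun x : E3 => pderiv3 k (pderiv3 j Ψ) x * pderiv3 i (pderiv3 k φ) x) volume :=
      fun k => hI (l2 k j) (hs2 i k) (hc2 i k)
    have iB : ∀ k, Integrable
      (fun x : E3 => pderiv3 i (pderiv3 j Ψ) x * pderiv3 k (pderiv3 k φ) x) volume :=
      fun k => hI (l2 i j) (hs2 k k) (hc2 k k)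
    have iC : Integrable (fun x : E3 => pderiv3 i (pderiv3 j Ψ) x * φ x) volume :=
      hI (l2 i j) hφ hc
    have sw := integrable_finsetSum Finset.univ fun k _ => iw k
    have sA := integrable_finsetSum Finset.univ fun k _ => iA k
    have sB := integrable_finsetSum Finset.univ fun k _ => iB k
    rw [hexp.trans (integral_combination iχ sw iφ sA sB iC _ _ _ _ _),
      integral_finsetSum _ fun k _ => iw k, integral_finsetSum _ fun k _ => iA k,
      integral_finsetSum _ fun k _ => iB k, integral_sphericalWave_mul k₁ hφ hc]
    -- all derivatives of the potential are moved to the test function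
    have eA : ∀ k, ∫ x, pderiv3 k (pderiv3 j Ψ) x * pderiv3 i (pderiv3 k φ) x =
        ∫ x, Ψ x * pderiv3 k (pderiv3 k χ) x := by
      intro k
      rw [hbp (hs2 i k) (hc2 i k), hχ, pderiv3_comm (hs2 i k) j k,
        pderiv3_comm (hφ.pderiv3 k) j i, pderiv3_comm hφ j k, pderiv3_comm (hφ.pderiv3 j) i k]
    have eB : ∀ k, ∫ x, pderiv3 i (pderiv3 j Ψ) x * pderiv3 k (pderiv3 k φ) x =
        ∫ x, Ψ x * pderiv3 k (pderiv3 k χ) x := by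
      intro k
      rw [hbp (hs2 k k) (hc2 k k), hχ, pderiv3_comm (hφ.pderiv3 k) i k, pderiv3_comm hφ i k,
        pderiv3_comm (hs2 k i) j k, pderiv3_comm (hφ.pderiv3 i) j k, pderiv3_comm hφ j i]
    have eC : ∫ x, pderiv3 i (pderiv3 j Ψ) x * φ x = ∫ x, Ψ x * χ x := by
      rw [hbp hφ hc, pderiv3_comm hφ]
    have eL : ∑ k, ∫ x, Ψ x * pderiv3 k (pderiv3 k χ) x =
        α₀ * (∫ x : E3, sphericalWave k₀ ‖x‖ * χ x) -
          α₁ * ∫ x : E3, sphericalWave k₁ ‖x‖ * χ x := by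
      simp only [← hbp hχs hχc]
      rw [← integral_finsetSum _ fun k _ => hI (l2 k k) hχs hχc, ← integral_const_mul,
        ← integral_const_mul, ← integral_sub ((hI (lw k₀) hχs hχc).const_mul _)
          ((hI (lw k₁) hχs hχc).const_mul _)]
      refine integral_congr_ae ?_
      filter_upwards [ae_ne_zero_E3] with x hx
      rw [← Finset.sum_mul, sum_pderiv3_pderiv3_of_radial hrad hu hu' hx,
        hode _ (norm_pos_iff.2 hx)]
      ring
    have eN : (∫ x : E3, sphericalWave k₀ ‖x‖ * χ x) - (∫ x : E3, sphericalWave k₁ ‖x‖ * χ x) +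
        κ * ∫ x, Ψ x * χ x = 0 := by
      have hd : Integrable
          (fun x : E3 => sphericalWave k₀ ‖x‖ * χ x - sphericalWave k₁ ‖x‖ * χ x) volume :=
        (hI (lw k₀) hχs hχc).sub (hI (lw k₁) hχs hχc)
      rw [← integral_const_mul, ← integral_sub (hI (lw k₀) hχs hχc) (hI (lw k₁) hχs hχc),
        ← integral_add hd ((hI l0 hχs hχc).const_mul _)]
      refine integral_eq_zero_of_ae ?_
      filter_upwards [ae_ne_zero_E3] with x hx
      have := hN _ (norm_pos_iff.2 hx)
      simp only [Pi.zero_apply, hΨdef]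
      linear_combination χ x * this
    simp only [eA, eB, eC, eL]
    set X₀ := ∫ x : E3, sphericalWave k₀ ‖x‖ * χ x
    set X₁ := ∫ x : E3, sphericalWave k₁ ‖x‖ * χ x
    set Y := ∫ x : E3, sphericalWave k₁ ‖x‖ * φ x
    -- `hμ₀` and `hμ₁` normalise the coefficients of `X₀` and `X₁` to those in `eN`; the terms in
    -- `Y` and `φ 0` are the scalar equation for `α₁ w_{k₁}`.
    linear_combination eN + X₀ * hμ₀ - X₁ * hμ₁ +
      (1 : Matrix (Fin 3) (Fin 3) ℂ) i j * Y * h₁ -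
      (1 : Matrix (Fin 3) (Fin 3) ℂ) i j * (φ 0 + k₁ ^ 2 * Y) * hμ₁

/-! ### The wave functions of the isotropic medium -/

namespace WaveData

variable {P : WaveData}

theorem sq_sqrt_div_mul (hρ : 0 < P.ρ) {m : ℝ} (hm : 0 < m) :
    √(m / P.ρ) ^ 2 * P.ρ = m := by
  rw [Real.sq_sqrt (by positivity)]
  field_simp

theorem τ_eq {i : Fin 3} {s : ℝ} (hs : 0 < s) (hb : ∀ j, P.b i j = s) (x : E3) :
    P.τ i x = ‖x‖ / s := by
  rw [τ, Real.sqrt_eq_iff_mul_self_eq (Finset.sum_nonneg fun j _ => by positivity)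
    (by positivity)]
  simp only [hb]
  rw [← Finset.sum_div]
  have := EuclideanSpace.norm_sq_eq x
  simp only [Real.norm_eq_abs, sq_abs] at this
  rw [← this]
  ring

/-- At travel time `r/s` the denominator `4πρ s³ · r/s` equals `4π m r`. -/
theorem profile_div_eq {i : Fin 3} {s m : ℝ} (hs : 0 < s) (hm : s ^ 2 * P.ρ = m)
    (hb : ∀ j, P.b i j = s) (r : ℝ) :
    P.profile i (r / s) = P.loss i / m * sphericalWave (P.K i / s) r := by
  have hsC : (s : ℂ) ≠ 0 := by exact_mod_cast hs.ne'
  rw [profile, sphericalWave, div_mul_div_comm]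
  simp only [Finset.prod_const, hb, Finset.card_univ, Fintype.card_fin]
  congr 1
  · congr 2
    push_cast
    field_simp
  · rw [← hm]
    push_cast
    field_simp

theorem Φ_eq {i : Fin 3} {s m : ℝ} (hs : 0 < s) (hm : s ^ 2 * P.ρ = m)
    (hb : ∀ j, P.b i j = s) (x : E3) :
    P.Φ i x = P.loss i / m * sphericalWave (P.K i / s) ‖x‖ := by
  rw [Φ, τ_eq hs hb, profile_div_eq hs hm hb]

/-- The relation `κ α = k²` linking amplitude and wavenumber. Of the branch of the square root, only
`sq z ^ 2 = z` is needed. -/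
theorem wavenumber_sq (hsq : ∀ z : ℂ, P.sq z ^ 2 = z) {s m : ℝ} (hs : 0 < s) (hρ : 0 < P.ρ)
    (hm : s ^ 2 * P.ρ = m) (i : Fin 3) :
    P.ρ * (P.freq : ℂ) ^ 2 * (P.loss i / m) = (P.K i / s) ^ 2 := by
  have hsC : (s : ℂ) ≠ 0 := by exact_mod_cast hs.ne'
  have hρC : (P.ρ : ℂ) ≠ 0 := by exact_mod_cast hρ.ne'
  rw [div_pow, K, hsq, ← hm]
  push_cast
  field_simp

theorem isScalarFundamental_Φ (hsq : ∀ z : ℂ, P.sq z ^ 2 = z) (hρ : 0 < P.ρ) {i : Fin 3}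
    {s m : ℝ} (hs : 0 < s) (hm : s ^ 2 * P.ρ = m) (hb : ∀ j, P.b i j = s)
    {q : Matrix (Fin 3) (Fin 3) ℝ} (hq : q = Matrix.diagonal ![m, m, m]) :
    IsScalarFundamental (toC q) (P.ρ * (P.freq : ℂ) ^ 2 * P.loss i) (-P.loss i) (P.Φ i) := by
  have hm0 : 0 < m := by rw [← hm]; positivity
  have hmC : (m : ℂ) ≠ 0 := by exact_mod_cast hm0.ne'
  have h := isScalarFundamental_sphericalWave (q := toC q) (m := m) (k := P.K i / s)
    (α := P.loss i / m) (fun φ x => by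
      subst hq
      simp [quadOp, toC, Fin.sum_univ_three, Matrix.diagonal_apply]
      ring)
  rw [← wavenumber_sq hsq hs hρ hm] at h
  convert h using 1
  · field_simp
  · field_simp
  · exact funext (Φ_eq hs hm hb)

theorem integral_sq_mul_profile {i : Fin 3} {s m : ℝ} (hs : 0 < s) (hm : s ^ 2 * P.ρ = m)
    (hb : ∀ j, P.b i j = s) (r : ℝ) :
    (s : ℂ) ^ 3 * ∫ h in (0 : ℝ)..(r / s), (h : ℂ) ^ 2 * P.profile i h =
      ∫ t in (0 : ℝ)..r, P.loss i / m *
        (t * Complex.exp (Complex.I * (P.K i / s) * t) / (4 * Real.pi)) := by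
  have hsC : (s : ℂ) ≠ 0 := by exact_mod_cast hs.ne'
  have h := intervalIntegral.integral_comp_div (a := 0) (b := r)
    (fun h : ℝ => (h : ℂ) ^ 2 * P.profile i h) hs.ne'
  rw [zero_div] at h
  have h3 : (s : ℂ) ^ 3 * ∫ h in (0 : ℝ)..(r / s), (h : ℂ) ^ 2 * P.profile i h =
      (s : ℂ) ^ 2 * (s • ∫ h in (0 : ℝ)..(r / s), (h : ℂ) ^ 2 * P.profile i h) := by
    rw [Complex.real_smul]
    ring
  rw [h3, ← h, ← intervalIntegral.integral_const_mul]
  refine intervalIntegral.integral_congr fun t _ => ?_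
  simp only [profile_div_eq hs hm hb, sphericalWave]
  -- At `t = 0` the profile divides by zero, but the factors of `t` make both sides vanish.
  by_cases ht : (t : ℂ) = 0
  · simp [ht]
  · have hpi : (Real.pi : ℂ) ≠ 0 := by simp [Real.pi_ne_zero]
    push_cast
    field_simp

end WaveData

/-! ### The isotropic Green function -/

section Isotropic

variable {P : WaveData}

/-- The Hessian of the potential contains `(Φ 0 - Φ 1) r̂⊗r̂`, which turns `Φ 1 I` into `Φ 0 r̂⊗r̂ +
Φ 1 (I - r̂⊗r̂)`. The rest is the flux integral, rescaled from distance to travel time in each mode.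
-/
theorem WaveData.isotropicGreen_apply (hρ : 0 < P.ρ) (hc11 : 0 < P.c.m11) (hc44 : 0 < P.c.m44)
    (hiso : P.c.m66 = P.c.m44) {Ψ : E3 → ℂ}
    (hΨ : IsPotential (normSqM vecD1) (fun x => P.Φ 0 x - P.Φ 1 x) Ψ) {x : E3} (hx : x ≠ 0)
    (i j : Fin 3) :
    P.isotropicGreen x i j =
      P.Φ 1 x * (1 : Matrix (Fin 3) (Fin 3) ℂ) i j + pderiv3 i (pderiv3 j Ψ) x := by
  have hs1 : 0 < P.c1 := Real.sqrt_pos.2 (by positivity)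
  have hs4 : 0 < P.c4 := Real.sqrt_pos.2 (by positivity)
  have hm1 : P.c1 ^ 2 * P.ρ = P.c.m11 := WaveData.sq_sqrt_div_mul hρ hc11
  have hm4 : P.c4 ^ 2 * P.ρ = P.c.m44 := WaveData.sq_sqrt_div_mul hρ hc44
  have hb0 : ∀ j, P.b 0 j = P.c1 := fun j => by fin_cases j <;> rfl
  have hc6 : P.c6 = P.c4 := by rw [WaveData.c6, WaveData.c4, hiso]
  have hb1 : ∀ j, P.b 1 j = P.c4 := fun j => by
    fin_cases j <;> simp [WaveData.b, hc6]
  set e : Fin 3 → ℝ → ℝ → ℝ → ℂ := fun i s m t => P.loss i / m *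
    (t * Complex.exp (Complex.I * (P.K i / s) * t) / (4 * Real.pi)) with he
  have hec : ∀ i s m, Continuous (e i s m) := fun i s m => by
    simp only [he]
    fun_prop
  have hes : ∀ (i : Fin 3) (s m t : ℝ), 0 < t → (t : ℂ) ^ 2 * (P.loss i / m *
      sphericalWave (P.K i / s) t) = e i s m t := by
    intro i s m t ht
    have htC : (t : ℂ) ≠ 0 := by exact_mod_cast ht.ne'
    have hpi : (Real.pi : ℂ) ≠ 0 := by simp [Real.pi_ne_zero]
    simp only [he, sphericalWave]
    field_simp
  have hint : ∫ t in (0 : ℝ)..‖x‖, (e 0 P.c1 P.c.m11 t - e 1 P.c4 P.c.m44 t) =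
      ((P.c1 : ℂ) ^ 3 * ∫ h in (0 : ℝ)..(‖x‖ / P.c1), (h : ℂ) ^ 2 * P.profile 0 h) -
        ((P.c4 : ℂ) ^ 3 * ∫ h in (0 : ℝ)..(‖x‖ / P.c4), (h : ℂ) ^ 2 * P.profile 1 h) := by
    rw [intervalIntegral.integral_sub ((hec _ _ _).intervalIntegrable _ _)
      ((hec _ _ _).intervalIntegrable _ _), WaveData.integral_sq_mul_profile hs1 hm1 hb0,
      WaveData.integral_sq_mul_profile hs4 hm4 hb1]
  have h := hΨ.pderiv3_pderiv3_eq
    (g := fun r => P.loss 0 / P.c.m11 * sphericalWave (P.K 0 / P.c1) r -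
      P.loss 1 / P.c.m44 * sphericalWave (P.K 1 / P.c4) r)
    (c := fun t => e 0 P.c1 P.c.m11 t - e 1 P.c4 P.c.m44 t)
    (fun x _ => by rw [WaveData.Φ_eq hs1 hm1 hb0, WaveData.Φ_eq hs4 hm4 hb1])
    ((hec _ _ _).sub (hec _ _ _)) (fun t ht => by rw [mul_sub, hes _ _ _ _ ht, hes _ _ _ _ ht])
    hx i j
  rw [h, hint, ← WaveData.Φ_eq hs1 hm1 hb0, ← WaveData.Φ_eq hs4 hm4 hb1]
  simp only [WaveData.isotropicGreen, Matrix.add_apply, Matrix.smul_apply, Matrix.sub_apply,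
    Matrix.of_apply, smul_eq_mul]
  push_cast
  ring

end Isotropic

theorem mainTheorem4 (P : WaveData) (v : Moduli ℝ)
    (hρ : 0 < P.ρ) (hc11 : 0 < P.c.m11) (hc44 : 0 < P.c.m44)
    (hsq : ∀ z : ℂ, P.sq z ^ 2 = z)
    (hβ : ∀ i n, quadSymbol (eigL v i) n = P.β i * quadSymbol (eigL P.c i) n)
    (hiso : P.c.m66 = P.c.m44) :
    -- the medium is isotropic
    (IsIsotropicTensor (mediumIIITensor P.c) ∧ IsIsotropicTensor (mediumIIITensor v)) ∧
    -- the two shear modes coincide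
    (P.β 1 = P.β 2 ∧
      (∀ x, P.τ 0 x = ‖x‖ / P.c1 ∧ P.τ 1 x = ‖x‖ / P.c4 ∧ P.τ 2 x = ‖x‖ / P.c4) ∧
      P.Φ 1 = P.Φ 2) ∧
    -- the scalar functions solve the Helmholtz equations of the three modes
    (∀ i, IsScalarFundamental (toC (eigL P.c i)) (P.ρ * (P.freq : ℂ) ^ 2 * P.loss i)
      (-P.loss i) (P.Φ i)) ∧
    -- the Green function of Medium III exists and is given by the closed form
    P.IsMediumIIIGreen P.isotropicGreen ∧
    (∀ G, P.IsMediumIIIGreen G → ∀ x, x ≠ 0 → G x = P.isotropicGreen x) ∧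
    -- the closed form is `Φ₂ I + D₁⊗D₁ M₁⁻¹ (Φ₁ - Φ₂)`
    (∀ Ψ, IsPotential (normSqM vecD1) (fun x => P.Φ 0 x - P.Φ 1 x) Ψ → ∀ x, x ≠ 0 →
      P.isotropicGreen x = P.Φ 1 x • (1 : Matrix (Fin 3) (Fin 3) ℂ) +
        Matrix.of fun a b => quadOp (toC (tensorSq vecD1 a b)) Ψ x) ∧
    -- it is a Green function of the viscoelastic wave operator in the frequency domain
    ((∀ i, P.loss i ≠ 0) →
      IsElasticFundamental P.viscoModuli (P.ρ * (P.freq : ℂ) ^ 2) (-1) P.isotropicGreen) := by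
  have hs1 : 0 < P.c1 := Real.sqrt_pos.2 (by positivity)
  have hs4 : 0 < P.c4 := Real.sqrt_pos.2 (by positivity)
  have hm1 : P.c1 ^ 2 * P.ρ = P.c.m11 := WaveData.sq_sqrt_div_mul hρ hc11
  have hm4 : P.c4 ^ 2 * P.ρ = P.c.m44 := WaveData.sq_sqrt_div_mul hρ hc44
  have hc6 : P.c6 = P.c4 := by rw [WaveData.c6, WaveData.c4, hiso]
  have hb0 : ∀ j, P.b 0 j = P.c1 := fun j => by fin_cases j <;> rfl
  have hb1 : ∀ j, P.b 1 j = P.c4 := fun j => by fin_cases j <;> simp [WaveData.b, hc6]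
  have hb2 : ∀ j, P.b 2 j = P.c4 := fun j => by fin_cases j <;> rfl
  -- Evaluation on the first and third basis vectors reads off `v66 = β 1 c66`, `v44 = β 1 c44` and
  -- `v44 = β 2 c44`.
  have q66 := hβ 1 (EuclideanSpace.single 0 1)
  have q44 := hβ 1 (EuclideanSpace.single 2 1)
  have q44' := hβ 2 (EuclideanSpace.single 2 1)
  simp [quadSymbol, eigL, Matrix.diagonal_apply] at q66 q44 q44'
  have hv : v.m66 = v.m44 := by rw [q66, q44, hiso]
  have hβ12 : P.β 1 = P.β 2 := mul_right_cancel₀ hc44.ne' (q44.symm.trans q44')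
  have hloss : P.loss 1 = P.loss 2 := by rw [WaveData.loss, WaveData.loss, hβ12]
  have hΦ : P.Φ 1 = P.Φ 2 := by
    funext x
    rw [WaveData.Φ_eq hs4 hm4 hb1, WaveData.Φ_eq hs4 hm4 hb2, WaveData.K, WaveData.K, hloss]
  have hα0 := WaveData.wavenumber_sq hsq hs1 hρ hm1 0
  have hα1 := WaveData.wavenumber_sq hsq hs4 hρ hm4 1
  obtain ⟨u, u', u'', hus, hu, hu', hode, hub, hub', hN⟩ := exists_radial_potential hα0 hα1
  have hpot : IsPotential (normSqM vecD1) (fun x => P.Φ 0 x - P.Φ 1 x) (fun x => u ‖x‖) :=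
    isPotential_of_radial
      (fun x _ => by rw [WaveData.Φ_eq hs1 hm1 hb0, WaveData.Φ_eq hs4 hm4 hb1]) hus hu hu' hode
      hub'
  have hclosed : ∀ Ψ, IsPotential (normSqM vecD1) (fun x => P.Φ 0 x - P.Φ 1 x) Ψ →
      ∀ x, x ≠ 0 → P.isotropicGreen x = P.Φ 1 x • (1 : Matrix (Fin 3) (Fin 3) ℂ) +
        Matrix.of fun a b => quadOp (toC (tensorSq vecD1 a b)) Ψ x := by
    intro Ψ hΨ x hx
    ext i j
    rw [WaveData.isotropicGreen_apply hρ hc11 hc44 hiso hΨ hx]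
    simp only [Matrix.add_apply, Matrix.smul_apply, Matrix.of_apply, quadOp_tensorSq_vecD1,
      smul_eq_mul]
  have hD2 : ∀ Ψ, IsPotential (normSqM vecD2) (fun x => P.Φ 1 x - P.Φ 2 x) Ψ → ∀ x, x ≠ 0 →
      (Matrix.of fun a b => quadOp (toC (tensorSq vecD2 a b)) Ψ x) = 0 := by
    intro Ψ hΨ x hx
    ext a b
    exact hΨ.quadOp_tensorSq_vecD2_eq_zero (fun y => by rw [hΦ, sub_self]) hx a b
  refine ⟨⟨isIsotropicTensor_mediumIIITensor hiso, isIsotropicTensor_mediumIIITensor hv⟩,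
    ⟨hβ12, fun x => ⟨WaveData.τ_eq hs1 hb0 x, WaveData.τ_eq hs4 hb1 x, WaveData.τ_eq hs4 hb2 x⟩,
      hΦ⟩, ?_, ?_, ?_, hclosed, ?_⟩
  · intro i
    fin_cases i
    · exact WaveData.isScalarFundamental_Φ hsq hρ hs1 hm1 hb0 rfl
    · exact WaveData.isScalarFundamental_Φ hsq hρ hs4 hm4 hb1 (by simp [eigL, hiso])
    · exact WaveData.isScalarFundamental_Φ hsq hρ hs4 hm4 hb2 rfl
  · have hz := isPotential_zero (normSqM vecD2) (f := fun x => P.Φ 1 x - P.Φ 2 x)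
      (fun y => by rw [hΦ, sub_self])
    -- Existence: the radial potential for the Laplacian, and zero for the horizontal one.
    refine ⟨_, _, hΦ ▸ hpot, hz, fun x hx => ?_⟩
    rw [hD2 _ hz x hx, add_zero, ← hΦ]
    exact hclosed _ hpot x hx
  · rintro G ⟨Ψ₁, Ψ₂, h1, h2, hG⟩ x hx
    rw [hG x hx, hD2 _ h2 x hx, add_zero, ← hΦ]
    rw [← hΦ] at h1
    exact (hclosed _ h1 x hx).symm
  · intro hl
    have hc11C : (P.c.m11 : ℂ) ≠ 0 := by exact_mod_cast hc11.ne'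
    have hc44C : (P.c.m44 : ℂ) ≠ 0 := by exact_mod_cast hc44.ne'
    have hl0 := hl 0
    have hl1 := hl 1
    refine isElasticFundamental_of_radial (μ := P.viscoModuli) ?_ ?_ ?_ hα1 hus hu hu' hode hub
      hub' hN fun x hx i j => ?_
    · simp only [WaveData.viscoModuli, hiso, hloss]
    · simp only [WaveData.viscoModuli]
      field_simp
    · simp only [WaveData.viscoModuli, ← hloss]
      field_simp
    · rw [WaveData.isotropicGreen_apply hρ hc11 hc44 hiso hpot hx, WaveData.Φ_eq hs4 hm4 hb1]
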